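/- **Theorem (lower bound, GRR with infinite packet queues).** *Model.* There are $\eta\ge 1$ groups of sources. Group $g$ has $n_g$ sources $(g,1),\dots,(g,n_g)$, $n=\sum_g n_g$ and $\alpha_g=n_g/n$. Let $b>0$ and let $1=d_1<d_2<\dots<d_\eta$ be integers with least common multiple $\tilde d$. The $k$-th packet of $(g,i)$, $k\ge1$, arrives at time $S_{g,i}(k)=d_g(k-1)nb$; also $S_{g,i}(0)=-d_gnb$. All packets are stored. A single server, free from time $0$ on, works in rounds $r=0,1,2,\dots$; in round $r$ it serves one packet of every source of every group $g$ with $d_g\mid r$, in the order $g=1,\dots,\eta$ and, inside a group, $i=1,\dots,n_g$ (first come first served for each source), waiting for the packet if it has not arrived yet. So packet $(g,i,k)$ is served in round $d_g(k-1)$. The transmission times $V_{g,i}(k)\ge 0$ are i.i.d. with a law $\nu$ such that $\Lambda(\theta)=\log\mathbb E\,e^{\theta V}\in(-\infty,\infty]$ is finite for some $\theta>0$. Let $D_{g,i}(k)$ be the departure time of packet $(g,i,k)$ and $A_{g,i}(k)=D_{g,i}(k)-S_{g,i}(k-1)$ its peak age. *Rate functions.* Let $m=m_{g,i}(k)$ be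 the number of packets served in round $d_g(k-1)$ up to and including packet $(g,i,k)$, divided by $n$. Put $k'=\lceil d_g(k-1)/\tilde d\rceil$ and $$\gamma^{(L,0)}_{g,i}(x,k,n)=I^{(L,0)}(x-d_gb),\qquad \gamma^{(L,\ell')}_{g,i}(x,k,n)=\ell'\,I^{(L,\ell')}\!\Big(\frac{x}{\ell'}+\frac{\ell'\tilde d-d_g}{\ell'}b\Big)\quad(1\le\ell'\le k'),$$ $$I^{(L,0)}(z)=\sup_{\theta>0}\{\theta z-m\Lambda(\theta)\},\qquad I^{(L,\ell')}(z)=\sup_{\theta>0}\Big\{\theta z-\frac{(\ell'-1)\sum_{j=1}^{\eta}\frac{\tilde d}{d_j}\alpha_j}{\ell'}\Lambda(\theta)-\frac{m}{\ell'}\Lambda(\theta)\Big\},$$ with values in $[0,\infty]$ (and $e^{-\infty}=0$). *Claim.* Fix $\eta,(d_j),b,\nu$, a group $g$, $k\ge1$, $x>0$ and $\epsilon>0$. Consider the bound $$\Pr\big(A_{g,i}(k)\ge nx\big)\ \ge\ \exp\Big\{-n\Big(\min_{0\le\ell'\le k'}\gamma^{(L,\ell')}_{g,i}(x,k,n)+\epsilon\Big)\Big\}.\tag{$*$}$$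 1. For every $\tau$ with $\Pr(V\ge\tau)>0$ there is $n_0$ such that $(*)$ holds for all group sizes with $n\ge n_0$ and all sources $(g,i)$ such that $x-d_gb\le m_{g,i}(k)\,\tau$ or $\Pr(m_{g,i}(k)V\ge x-d_gb)=0$. (In particular, if $V$ is unbounded, then for every $\mu>0$ the bound holds for all sufficiently large $n$, simultaneously for all sources with $m_{g,i}(k)\ge\mu$. For every law and every fixed value $m>0$, it holds for all sufficiently large $n$ and all sources with $m_{g,i}(k)=m$.) 2. Suppose that $V$ is unbounded and that for every $\delta>0$ one has $\Pr(V\ge t)\ge \exp\{-\sup_{\theta>0}(\theta t-\Lambda(\theta))-\delta t\}$ for all large $t$ (as for exponential and geometric $V$). Then there is $n_0$ such that $(*)$ holds for all group sizes with $n\ge n_0$ and all sources $(g,i)$ of group $g$. -/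

import Mathlib

open MeasureTheory ProbabilityTheory Filter
open scoped ENNReal

universe u

noncomputable section

namespace GRR

/-- Sources `(g, i)`: there are `η` groups and group `g` has `N g` sources. Groups, and
sources inside a group, are numbered from `0`, so that the first source of all is `(0, 0)`. -/
abbrev Source {η : ℕ} (N : Fin η → ℕ) : Type := Σ g : Fin η, Fin (N g)

/-- Packets `((g, i), k)`; the packets of a source are numbered `k = 1, 2, 3, …`. -/
abbrev Packet {η : ℕ} (N : Fin η → ℕ) : Type := Source N × ℕ

variable {η : ℕ} (d N : Fin η → ℕ) (b : ℝ)

/-- The total number `n` of sources. -/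
def numSources : ℕ := ∑ g, N g

/-- The arrival (generation) time `S_{g,i}(k) = d_g (k - 1) n b` of the `k`-th packet of a source of
group `g`. The first packets of all sources arrive together at time `0`, and `S_{g,i}(0) = - d_g n b`
is one period earlier. -/
def arrival (g : Fin η) (k : ℕ) : ℝ := d g * ((k : ℝ) - 1) * (numSources N * b)

/-- The sources served in round `r = 0, 1, 2, …`, in the order of service: those of the groups `g`
with `r ≡ 0 (mod d_g)`, group after group, and in round-robin order inside each group. -/
def roundList (r : ℕ) : List (Source N) :=
  ((List.finRange η).filter fun g => d g ∣ r).flatMap fun g =>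
    (List.finRange (N g)).map fun i => ⟨g, i⟩

/-- The packet of source `s` that is served in round `r`. If `d_g ∣ r`, it is the packet with number
`r / d_g + 1`. -/
def packetIn (r : ℕ) (s : Source N) : Packet N := (s, r / d s.1 + 1)

/-- `s'` comes no later than `s` in the service order inside a round. -/
def Upto (s s' : Source N) : Prop := s'.1 < s.1 ∨ s'.1 = s.1 ∧ s'.2.val ≤ s.2.val

instance (s : Source N) : DecidablePred (Upto N s) := fun _ => by
  unfold Upto; infer_instance

/-- The packets of the round that contains the `k`-th packet of `s`, from the first one of that round
up to and including the `k`-th packet of `s`. This is the round `d_g (k - 1)`. -/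
def Jminus (s : Source N) (k : ℕ) : List (Packet N) :=
  (((roundList d N (d s.1 * (k - 1))).filter fun s' => Upto N s s')).map
    (packetIn d N (d s.1 * (k - 1)))

/-- `m_{g,i}(k)`: the number of packets in `Jminus`, divided by `n`. -/
def mRatio (s : Source N) (k : ℕ) : ℝ := ((Jminus d N s k).length : ℝ) / numSources N

variable (V : Packet N → ℝ)

/-- A single server that is free from time `t` on and serves the given packets in the given order,
each one for the time `V p` and not before its arrival: the time of the last departure. -/
def serveAll (t : ℝ) (l : List (Packet N)) : ℝ :=
  l.foldl (fun u p => max u (arrival d N b p.1.1 p.2) + V p) t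

/-- The time at which the server is done with all the rounds before round `r`. -/
def roundStart : ℕ → ℝ
  | 0 => 0
  | r + 1 => serveAll d N b V (roundStart r) ((roundList d N r).map (packetIn d N r))

/-- The departure time `D_{g,i}(k)` (for `k ≥ 1`) under generalized round robin with infinite queues. -/
def departure (s : Source N) (k : ℕ) : ℝ :=
  serveAll d N b V (roundStart d N b V (d s.1 * (k - 1))) (Jminus d N s k)

/-- The peak age `A_{g,i}(k) = D_{g,i}(k) - S_{g,i}(k-1)` (for `k ≥ 1`). -/
def peakAge (s : Source N) (k : ℕ) : ℝ :=
  departure d N b V s k - arrival d N b s.1 (k - 1)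

/-- The logarithm `Λ(θ)` of the moment generating function of `ν`, with value `+∞` where the moment
generating function is infinite. -/
def logMGF (ν : Measure ℝ) (θ : ℝ) : EReal :=
  ENNReal.log (∫⁻ v, ENNReal.ofReal (Real.exp (θ * v)) ∂ν)

/-- `sup_{θ > 0} (θ x - m Λ(θ))`. -/
def rateZero (ν : Measure ℝ) (m x : ℝ) : EReal :=
  ⨆ θ : {θ : ℝ // 0 < θ}, (((θ : ℝ) * x : ℝ) : EReal) - (m : EReal) * logMGF ν θ

/-- The number `d̃` of rounds in an iteration. -/
def dTilde : ℕ := Finset.univ.lcm d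

/-- `∑_j (d̃ / d_j) α_j`, where `α_j = n_j / n`. -/
def loadRatio : ℝ := ∑ j, ((dTilde d : ℝ) / d j) * ((N j : ℝ) / numSources N)

/-- `I^{(L,ℓ)}(x) = sup_{θ > 0} (θ x - (ℓ - 1) (∑_j (d̃/d_j) α_j) / ℓ · Λ(θ) - m / ℓ · Λ(θ))` for
`ℓ ≥ 1`. -/
def ratePos (ν : Measure ℝ) (m : ℝ) (l : ℕ) (x : ℝ) : EReal :=
  ⨆ θ : {θ : ℝ // 0 < θ}, (((θ : ℝ) * x : ℝ) : EReal)
    - ((((l : ℝ) - 1) * loadRatio d N / l : ℝ) : EReal) * logMGF ν θ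
    - ((m / l : ℝ) : EReal) * logMGF ν θ

/-- `γ^{(L,ℓ)}_{g,i}(x, k, n)`. -/
def gammaL (ν : Measure ℝ) (s : Source N) (k : ℕ) (x : ℝ) (l : ℕ) : EReal :=
  if l = 0 then rateZero ν (mRatio d N s k) (x - d s.1 * b)
  else ((l : ℝ) : EReal) * ratePos d N ν (mRatio d N s k) l
    (x / l + ((l : ℝ) * dTilde d - d s.1) / l * b)

/-- `k' = ⌈(k̃ - 1) / d̃⌉`, where `k̃ = d_g (k - 1) + 1`. -/
def kPrime (g : Fin η) (k : ℕ) : ℕ :=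
  ⌈(((d g * (k - 1) + 1 : ℕ) : ℝ) - 1) / (dTilde d : ℝ)⌉₊

/-- The lower bound on the age violation probability of packet `((g, i), k)`, for a system whose
transmission times are independent with law `ν`, on an arbitrary probability space. -/
def LowerBoundHolds (ν : Measure ℝ) (s : Source N) (k : ℕ) (x ε : ℝ) : Prop :=
  ∀ (Ω : Type u) [MeasurableSpace Ω] (P : Measure Ω) [IsProbabilityMeasure P]
    (V : Packet N → Ω → ℝ), (∀ p, HasLaw (V p) ν P) → iIndepFun V P →
    EReal.exp (-(((numSources N : ℝ) : EReal) *
        ((⨅ l : Fin (kPrime d s.1 k + 1), gammaL d N b ν s k x l) + (ε : EReal))))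
      ≤ P {ω | numSources N * x ≤ peakAge d N b (fun p => V p ω) s k}

/-- `P(V ≥ t) ≥ exp (-(Λ*(t) + δ t))` for every `δ > 0` and all large `t`, where
`Λ*(t) = sup_{θ > 0} (θ t - Λ(θ))`: for a single packet, Chernoff's bound gives the tail up to a
factor `e^{o(t)}`. -/
def RegularTail (ν : Measure ℝ) : Prop :=
  ∀ δ : ℝ, 0 < δ → ∀ᶠ t : ℝ in atTop,
    EReal.exp (-(rateZero ν 1 t + ((δ * t : ℝ) : EReal))) ≤ ν (Set.Ici t)

end GRR

end

/-! A packet cannot leave before the work ahead of it is done. Look back `q` iterations, to a round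
that also serves this source: the server cannot begin it before its packets arrive, and afterwards
at least the service times add up. Subtracting `S_{g,i}(k-1)` gives `A ≥ n (d_g - q d̃) b + S_M`,
where `S_M` sums `M = n (q ∑ (d̃/d_j) α_j + m)` distinct, hence independent, service times
(`le_peakAge`, `length_recentPackets`). It remains to bound `P(S_M ≥ n z)` from below for `z = x +
(q d̃ - d_g) b`, uniformly in `M / n`, which varies with the group sizes.

Cramér's lower bound is obtained without tilting. The function `M ↦ -log P(S_M ≥ M c)` is
subadditive, so it has a linear rate, convex in `c`. A supporting line of this rate bounds all tails
geometrically, hence bounds `Λ`; so the rate is at most the Legendre transform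
(`exists_decayRate_le`). Convexity and a finite grid make the bound uniform (`cramer_uniform`).

The rate for `ℓ' = q + 1` has load `M / n` but threshold `z + d̃ b`. For `q ≥ 1` this slack absorbs
the edge of the support of `V` (`exp_rate_le_convPow_of_slack`). For `q = 0` it shows that `ℓ' = 1`
follows from `ℓ' = 0`. Only `ℓ' = 0` has no slack and possibly few summands, so only there do the
conditions on `m` or on the tail enter. -/

noncomputable section

namespace GRR

/-! ### Sums of independent variables and their tails -/

/-- The `M`-fold convolution power of `ν`: the law of a sum of `M` independent variables with
law `ν`. -/
def convPow (ν : Measure ℝ) : ℕ → Measure ℝ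
  | 0 => Measure.dirac 0
  | M + 1 => ν ∗ convPow ν M

lemma convPow_Ici_eq_zero {ν : Measure ℝ} {a : ℝ} (ha : ν (Set.Ici a) = 0) {M : ℕ} (hM : M ≠ 0) :
    convPow ν M (Set.Ici (M * a)) = 0 := by
  have hlt : ∀ᵐ v ∂ν, v < a := by
    rw [ae_iff]; simpa [Set.Ici] using ha
  -- Only the weak inequality survives at `M = 0`; one further summand makes it strict.
  have key : ∀ M : ℕ, ∀ᵐ x ∂convPow ν M, x ≤ M * a := by
    intro M
    induction M with
    | zero => simp [convPow, ae_dirac_eq]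
    | succ M ih =>
      simp only [convPow, Measure.conv]
      rw [ae_map_iff (by fun_prop) measurableSet_Iic]
      filter_upwards [Measure.quasiMeasurePreserving_fst.ae hlt,
        Measure.quasiMeasurePreserving_snd.ae ih] with x h1 h2
      push_cast; linarith
  obtain ⟨M, rfl⟩ := Nat.exists_eq_succ_of_ne_zero hM
  have : ∀ᵐ x ∂convPow ν (M + 1), x < ((M + 1 : ℕ) : ℝ) * a := by
    simp only [convPow, Measure.conv]
    rw [ae_map_iff (by fun_prop) measurableSet_Iio]
    filter_upwards [Measure.quasiMeasurePreserving_fst.ae hlt,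
      Measure.quasiMeasurePreserving_snd.ae (key M)] with x h1 h2
    push_cast; linarith
  rw [ae_iff] at this
  simpa [Set.Ici] using this

section ConvPow

variable (ν : Measure ℝ) [IsProbabilityMeasure ν]

instance isProbabilityMeasure_convPow (M : ℕ) : IsProbabilityMeasure (convPow ν M) := by
  induction M with
  | zero => unfold convPow; infer_instance
  | succ M ih => unfold convPow; infer_instance

lemma convPow_one : convPow ν 1 = ν := by
  simp [convPow]

lemma convPow_add (M M' : ℕ) : convPow ν (M + M') = convPow ν M ∗ convPow ν M' := by
  induction M with
  | zero => simp [convPow]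
  | succ M ih =>
    rw [show M + 1 + M' = (M + M') + 1 by ring]
    simp only [convPow]
    rw [ih, Measure.conv_assoc]

lemma conv_Ici_ge (μ₁ μ₂ : Measure ℝ) [IsProbabilityMeasure μ₁] [IsProbabilityMeasure μ₂]
    (a b : ℝ) : μ₁ (Set.Ici a) * μ₂ (Set.Ici b) ≤ (μ₁ ∗ μ₂) (Set.Ici (a + b)) := by
  rw [Measure.conv, Measure.map_apply (by fun_prop) measurableSet_Ici, ← Measure.prod_prod]
  refine measure_mono ?_
  rintro ⟨x, y⟩ ⟨hx, hy⟩
  simp only [Set.mem_Ici, Set.mem_preimage] at *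
  linarith

lemma convPow_mul_le (M M' : ℕ) (a b : ℝ) :
    convPow ν M (Set.Ici a) * convPow ν M' (Set.Ici b)
      ≤ convPow ν (M + M') (Set.Ici (a + b)) := by
  rw [convPow_add]; exact conv_Ici_ge _ _ _ _

/-- All summands may be large at once. This crude bound gives positivity of the tails, the case of
an atom at the right end, and the case of few summands. -/
lemma pow_le_convPow (M : ℕ) (a : ℝ) :
    ν (Set.Ici a) ^ M ≤ convPow ν M (Set.Ici (M * a)) := by
  induction M with
  | zero => simp [convPow]
  | succ M ih =>
    have := conv_Ici_ge ν (convPow ν M) a (M * a)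
    rw [pow_succ, mul_comm]
    refine (mul_le_mul_right ih _).trans (this.trans_eq ?_)
    simp only [convPow]; congr 2; push_cast; ring

variable {ν} in
lemma convPow_Ici_of_nonpos (hν : ∀ᵐ v ∂ν, 0 ≤ v) (M : ℕ) {a : ℝ} (ha : a ≤ 0) :
    convPow ν M (Set.Ici a) = 1 := by
  refine le_antisymm prob_le_one ?_
  have h1 : ν (Set.Ici 0) = 1 := prob_compl_eq_zero_iff measurableSet_Ici |>.1 hν
  have := pow_le_convPow ν M 0
  rw [h1, one_pow, mul_zero] at this
  exact this.trans (measure_mono (Set.Ici_subset_Ici.2 ha))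

lemma lintegral_exp_convPow (θ : ℝ) (M : ℕ) :
    ∫⁻ x, ENNReal.ofReal (Real.exp (θ * x)) ∂convPow ν M
      = (∫⁻ v, ENNReal.ofReal (Real.exp (θ * v)) ∂ν) ^ M := by
  induction M with
  | zero => simp [convPow, lintegral_dirac]
  | succ M ih =>
    simp only [convPow]
    rw [Measure.lintegral_conv (by fun_prop)]
    simp_rw [mul_add, Real.exp_add, ENNReal.ofReal_mul (Real.exp_pos _).le]
    have : ∀ x : ℝ, ∫⁻ y, ENNReal.ofReal (Real.exp (θ * x)) * ENNReal.ofReal (Real.exp (θ * y))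
        ∂convPow ν M = ENNReal.ofReal (Real.exp (θ * x)) *
          (∫⁻ v, ENNReal.ofReal (Real.exp (θ * v)) ∂ν) ^ M := fun x => by
      rw [lintegral_const_mul _ (by fun_prop), ih]
    simp_rw [this]
    rw [lintegral_mul_const _ (by fun_prop), pow_succ, mul_comm]

/-- Sums of distinct independent variables with law `ν` follow the convolution power. -/
lemma hasLaw_list_sum {ι : Type*} {Ω : Type*} [MeasurableSpace Ω] {P : Measure Ω}
    [IsProbabilityMeasure P] {V : ι → Ω → ℝ} (hV : ∀ p, HasLaw (V p) ν P) (hi : iIndepFun V P)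
    (l : List ι) (hl : l.Nodup) :
    HasLaw (fun ω => (l.map fun p => V p ω).sum) (convPow ν l.length) P := by
  classical
  induction l with
  | nil => exact ⟨by simp, by simp [convPow]⟩
  | cons p l ih =>
    obtain ⟨hp, hl⟩ := List.nodup_cons.1 hl
    have hsum : (fun ω => (l.map fun p => V p ω).sum) = ∑ q ∈ l.toFinset, V q := by
      ext ω; rw [Finset.sum_apply, List.sum_toFinset _ hl]
    have hind : V p ⟂ᵢ[P] (fun ω => (l.map fun p => V p ω).sum) := by
      rw [hsum]
      exact (hi.indepFun_finsetSum_of_notMem₀ (fun q => (hV q).aemeasurable)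
        (by simpa using hp)).symm
    have := hind.hasLaw_add (hV p) (ih hl)
    simpa [convPow, Function.comp_def, Pi.add_def] using this

end ConvPow

/-! ### The exponential decay rate by subadditivity, and its convexity -/

/-- `-log P(S_M ≥ M c)`, where `S_M` is a sum of `M` independent variables with law `ν`. -/
def negLogTail (ν : Measure ℝ) (c : ℝ) (M : ℕ) : ℝ :=
  -Real.log ((convPow ν M).real (Set.Ici (M * c)))

/-- The exponential decay rate of `P(S_M ≥ M c)`. -/
def decayRate (ν : Measure ℝ) (c : ℝ) : ℝ :=
  sInf ((fun M : ℕ => negLogTail ν c M / M) '' Set.Ici 1)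

section Decay

lemma ordConnected_tail {ν : Measure ℝ} : Set.OrdConnected {c | 0 < ν (Set.Ici c)} :=
  ⟨fun _ _ _ hb _ hc => hb.trans_le (measure_mono (Set.Ici_subset_Ici.2 hc.2))⟩

variable {ν : Measure ℝ} [IsProbabilityMeasure ν]

lemma convPow_real_pos {c : ℝ} (hc : 0 < ν (Set.Ici c)) (M : ℕ) :
    0 < (convPow ν M).real (Set.Ici (M * c)) := by
  rw [measureReal_def, ENNReal.toReal_pos_iff]
  exact ⟨(ENNReal.pow_pos hc M).trans_le (pow_le_convPow ν M c), measure_lt_top _ _⟩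

lemma negLogTail_nonneg (c : ℝ) (M : ℕ) : 0 ≤ negLogTail ν c M :=
  neg_nonneg.2 (Real.log_nonpos measureReal_nonneg measureReal_le_one)

lemma bddBelow_negLogTail_div (c : ℝ) :
    BddBelow (Set.range fun M : ℕ => negLogTail ν c M / M) :=
  ⟨0, by rintro _ ⟨M, rfl⟩; exact div_nonneg (negLogTail_nonneg c M) M.cast_nonneg⟩

/-- Two separate blocks may reach their own levels `a` and `b`: equal levels yield subadditivity,
different ones convexity. Positive tails exclude the default `Real.log 0 = 0`. -/
lemma negLogTail_add_le {a b c : ℝ} (ha : 0 < ν (Set.Ici a)) (hb : 0 < ν (Set.Ici b)) {M M' : ℕ}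
    (h : ((M + M' : ℕ) : ℝ) * c ≤ M * a + M' * b) :
    negLogTail ν c (M + M') ≤ negLogTail ν a M + negLogTail ν b M' := by
  unfold negLogTail
  rw [← neg_add, neg_le_neg_iff,
    ← Real.log_mul (convPow_real_pos ha M).ne' (convPow_real_pos hb M').ne']
  refine Real.log_le_log (mul_pos (convPow_real_pos ha M) (convPow_real_pos hb M')) ?_
  rw [measureReal_def, measureReal_def, measureReal_def, ← ENNReal.toReal_mul]
  exact ENNReal.toReal_mono (measure_ne_top _ _)
    ((convPow_mul_le ν M M' _ _).trans (measure_mono (Set.Ici_subset_Ici.2 h)))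

lemma subadditive_negLogTail {c : ℝ} (hc : 0 < ν (Set.Ici c)) : Subadditive (negLogTail ν c) :=
  fun M M' => negLogTail_add_le hc hc (by push_cast; linarith)

lemma lim_negLogTail {c : ℝ} (hc : 0 < ν (Set.Ici c)) :
    (subadditive_negLogTail hc).lim = decayRate ν c := by
  rw [Subadditive.lim, decayRate]

lemma tendsto_negLogTail_div {c : ℝ} (hc : 0 < ν (Set.Ici c)) :
    Tendsto (fun M : ℕ => negLogTail ν c M / M) atTop (nhds (decayRate ν c)) :=
  lim_negLogTail hc ▸ (subadditive_negLogTail hc).tendsto_lim (bddBelow_negLogTail_div c)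

lemma decayRate_nonneg (c : ℝ) : 0 ≤ decayRate ν c :=
  Real.sInf_nonneg <| by
    rintro _ ⟨M, -, rfl⟩; exact div_nonneg (negLogTail_nonneg c M) M.cast_nonneg

/-- The Fekete limit is an infimum, so the bound has no error term at any `M ≥ 1`. -/
lemma convPow_real_le_exp {c : ℝ} (hc : 0 < ν (Set.Ici c)) {M : ℕ} (hM : M ≠ 0) :
    (convPow ν M).real (Set.Ici (M * c)) ≤ Real.exp (-(M * decayRate ν c)) := by
  rw [← Real.log_le_iff_le_exp (convPow_real_pos hc M), le_neg]
  have h := (subadditive_negLogTail hc).lim_le_div (bddBelow_negLogTail_div c) hM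
  rw [lim_negLogTail hc] at h
  have hM' : (0 : ℝ) < M := by positivity
  rw [le_div_iff₀ hM', mul_comm] at h
  exact h

lemma decayRate_zero (hν : ∀ᵐ v ∂ν, 0 ≤ v) : decayRate ν 0 = 0 := by
  refine le_antisymm ?_ (decayRate_nonneg 0)
  refine csInf_le ⟨0, ?_⟩ ⟨1, by simp, ?_⟩
  · rintro _ ⟨M, -, rfl⟩; exact div_nonneg (negLogTail_nonneg 0 M) M.cast_nonneg
  · simp [negLogTail, measureReal_def, convPow_Ici_of_nonpos hν 1 le_rfl]

/-- Of `M` summands, let `⌊α M⌋` average at least `x` and the others at least `y`, then divide by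
`M` and pass to the limit. -/
lemma convexOn_decayRate : ConvexOn ℝ {c | 0 < ν (Set.Ici c)} (decayRate ν) := by
  refine LinearOrder.convexOn_of_lt ordConnected_tail.convex ?_
  intro x hx y hy hxy α β hα hβ hαβ
  have hz : 0 < ν (Set.Ici (α • x + β • y)) :=
    ordConnected_tail.convex hx hy hα.le hβ.le hαβ
  have hfl := tendsto_nat_floor_mul_div_atTop (R := ℝ) hα.le
  have hfl' : Tendsto (fun M : ℕ => (⌊α * (M : ℝ)⌋₊ : ℝ) / M) atTop (nhds α) :=
    hfl.comp tendsto_natCast_atTop_atTop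
  have hle : ∀ M : ℕ, ⌊α * (M : ℝ)⌋₊ ≤ M := fun M => by
    refine Nat.floor_le_of_le ?_
    nlinarith [(Nat.cast_nonneg M : (0 : ℝ) ≤ M)]
  have hbeta : Tendsto (fun M : ℕ => ((M - ⌊α * (M : ℝ)⌋₊ : ℕ) : ℝ) / M) atTop (nhds β) := by
    have : Tendsto (fun M : ℕ => 1 - (⌊α * (M : ℝ)⌋₊ : ℝ) / M) atTop (nhds β) := by
      rw [show β = 1 - α by linarith]; exact hfl'.const_sub 1
    refine this.congr' ?_
    filter_upwards [eventually_ge_atTop 1] with M hM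
    rw [Nat.cast_sub (hle M), sub_div, div_self (by positivity)]
  have hj : Tendsto (fun M : ℕ => ⌊α * (M : ℝ)⌋₊) atTop atTop :=
    tendsto_nat_floor_atTop.comp (tendsto_natCast_atTop_atTop.const_mul_atTop hα)
  have hj' : Tendsto (fun M : ℕ => M - ⌊α * (M : ℝ)⌋₊) atTop atTop := by
    refine tendsto_natCast_atTop_iff (R := ℝ) |>.1 ?_
    refine tendsto_atTop_mono (fun M => ?_)
      ((tendsto_natCast_atTop_atTop (R := ℝ)).const_mul_atTop hβ)
    rw [Nat.cast_sub (hle M)]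
    have := Nat.floor_le (a := α * (M : ℝ)) (by positivity)
    have : β = 1 - α := by linarith
    rw [this]; linarith
  have hscale : ∀ (j : ℕ → ℕ) (c t : ℝ), 0 < ν (Set.Ici c) → Tendsto j atTop atTop →
      Tendsto (fun M : ℕ => (j M : ℝ) / M) atTop (nhds t) →
      Tendsto (fun M : ℕ => negLogTail ν c (j M) / M) atTop (nhds (t * decayRate ν c)) := by
    intro j c t hc hj ht
    refine (ht.mul ((tendsto_negLogTail_div hc).comp hj)).congr' ?_
    filter_upwards [hj.eventually_ge_atTop 1] with M hM
    have : (j M : ℝ) ≠ 0 := by positivity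
    simp only [Function.comp]
    field_simp
  refine le_of_tendsto_of_tendsto' (tendsto_negLogTail_div hz)
    ((hscale _ x α hx hj hfl').add (hscale _ y β hy hj' hbeta)) fun M => ?_
  rw [← add_div]
  refine div_le_div_of_nonneg_right ?_ M.cast_nonneg
  have hM : ⌊α * (M : ℝ)⌋₊ + (M - ⌊α * (M : ℝ)⌋₊) = M := Nat.add_sub_cancel' (hle M)
  conv_lhs => rw [← hM]
  refine negLogTail_add_le hx hy ?_
  rw [hM, Nat.cast_sub (hle M)]
  have h1 := Nat.floor_le (a := α * (M : ℝ)) (by positivity)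
  have : β = 1 - α := by linarith
  subst this
  simp only [smul_eq_mul]
  -- Since `x < y`, rounding down the number of summands at the lower level `x` only raises the
  -- total.
  nlinarith [mul_nonneg (sub_nonneg.2 h1) (sub_nonneg.2 hxy.le)]

end Decay

/-- The supremum of the left slopes at `a` serves as `s`; any slope to the right bounds it. -/
lemma exists_subgradient {D : Set ℝ} {f : ℝ → ℝ} (hf : ConvexOn ℝ D f) {l a r : ℝ} (hl : l ∈ D)
    (hr : r ∈ D) (hla : l < a) (har : a < r) : ∃ s : ℝ, ∀ c ∈ D, f a + s * (c - a) ≤ f c := by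
  have hbdd : BddAbove ((fun c => (f a - f c) / (a - c)) '' {c ∈ D | c < a}) := by
    refine ⟨(f r - f a) / (r - a), ?_⟩
    rintro _ ⟨c, ⟨hc, hca⟩, rfl⟩
    exact hf.slope_mono_adjacent hc hr hca har
  have hne : ((fun c => (f a - f c) / (a - c)) '' {c ∈ D | c < a}).Nonempty := ⟨_, l, ⟨hl, hla⟩, rfl⟩
  refine ⟨sSup ((fun c => (f a - f c) / (a - c)) '' {c ∈ D | c < a}), fun c hc => ?_⟩
  rcases lt_trichotomy c a with h | rfl | h
  · have := le_csSup hbdd ⟨c, ⟨hc, h⟩, rfl⟩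
    rw [div_le_iff₀ (sub_pos.2 h)] at this
    linarith
  · simp
  · have : sSup ((fun c => (f a - f c) / (a - c)) '' {c ∈ D | c < a}) ≤ (f c - f a) / (c - a) := by
      refine csSup_le hne ?_
      rintro _ ⟨c', ⟨hc', hca⟩, rfl⟩
      exact hf.slope_mono_adjacent hc' hc hca h
    rw [le_div_iff₀ (sub_pos.2 h)] at this
    linarith

/-! ### From tail bounds to the cumulant generating function -/

section Rates

variable {ν : Measure ℝ} [IsProbabilityMeasure ν]

lemma lintegral_exp_eq_ofReal_exp_cgf {θ : ℝ} (h : Integrable (fun v => Real.exp (θ * v)) ν) :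
    ∫⁻ v, ENNReal.ofReal (Real.exp (θ * v)) ∂ν = ENNReal.ofReal (Real.exp (cgf id ν θ)) := by
  rw [exp_cgf (X := id) h, mgf]
  simp only [id]
  rw [ofReal_integral_eq_lintegral_ofReal h
    (ae_of_all _ fun _ => (Real.exp_pos _).le)]

lemma logMGF_eq_cgf {θ : ℝ} (h : Integrable (fun v => Real.exp (θ * v)) ν) :
    logMGF ν θ = (cgf id ν θ : EReal) := by
  rw [logMGF, lintegral_exp_eq_ofReal_exp_cgf h, ← EReal.exp_coe, EReal.log_exp]

/-- Small `θ` make `θ z - λ Λ(θ)` almost nonnegative. -/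
lemma exists_rate_ge_neg (hν : ∀ᵐ v ∂ν, 0 ≤ v)
    (hmgf : ∃ θ : ℝ, 0 < θ ∧ Integrable (fun v => Real.exp (θ * v)) ν) (z r : ℝ) {δ : ℝ}
    (hδ : 0 < δ) : ∃ θ : ℝ, 0 < θ ∧ Integrable (fun v => Real.exp (θ * v)) ν ∧
      -δ ≤ θ * z - r * cgf id ν θ := by
  obtain ⟨θ₀, hθ₀, hint⟩ := hmgf
  -- As `V ≥ 0`, negative `θ` are harmless, so `0` is interior and the cgf is continuous there with
  -- value `0`.
  have hsub : Set.Iio θ₀ ⊆ integrableExpSet id ν := by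
    intro t ht
    rcases le_total 0 t with h | h
    · exact integrable_exp_mul_of_nonneg_of_le hint h (le_of_lt ht)
    · refine Integrable.of_bound (by fun_prop) 1 ?_
      filter_upwards [hν] with v hv
      rw [Real.norm_of_nonneg (Real.exp_pos _).le, Real.exp_le_one_iff]
      exact mul_nonpos_of_nonpos_of_nonneg h hv
  have h0 : (0 : ℝ) ∈ interior (integrableExpSet id ν) :=
    interior_maximal hsub isOpen_Iio hθ₀
  have hc : ContinuousAt (fun θ : ℝ => θ * z - r * cgf id ν θ) 0 :=
    (continuousAt_id.mul continuousAt_const).sub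
      (continuousAt_const.mul (analyticAt_cgf h0).continuousAt)
  have hev : ∀ᶠ θ in nhds (0 : ℝ), -δ < θ * z - r * cgf id ν θ :=
    hc.eventually (lt_mem_nhds (by simpa using hδ))
  have hev2 : ∀ᶠ θ in nhdsWithin (0 : ℝ) (Set.Ioi 0), 0 < θ ∧ θ < θ₀ ∧
      -δ < θ * z - r * cgf id ν θ := by
    filter_upwards [self_mem_nhdsWithin, nhdsWithin_le_nhds (gt_mem_nhds hθ₀),
      nhdsWithin_le_nhds hev] with θ h1 h2 h3
    exact ⟨h1, h2, h3⟩
  obtain ⟨θ, h1, h2, h3⟩ := hev2.exists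
  exact ⟨θ, h1, hsub h2, h3.le⟩

/-- A geometric bound on the tails of a nonnegative variable bounds its exponential moments. -/
lemma lintegral_exp_le_of_tail (μ : Measure ℝ) (hμ : ∀ᵐ x ∂μ, 0 ≤ x) {s θ A : ℝ}
    (hθ : 0 ≤ θ) (hs : θ < s) (hA : 0 ≤ A)
    (h : ∀ j : ℕ, μ (Set.Ici (j : ℝ)) ≤ ENNReal.ofReal (A * Real.exp (-(s * j)))) :
    ∫⁻ x, ENNReal.ofReal (Real.exp (θ * x)) ∂μ
      ≤ ENNReal.ofReal (A * (Real.exp θ * (1 - Real.exp (-(s - θ)))⁻¹)) := by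
  have hpt : ∀ᵐ x ∂μ, ENNReal.ofReal (Real.exp (θ * x)) ≤
      ∑' j : ℕ, (Set.Ici (j : ℝ)).indicator
        (fun _ => ENNReal.ofReal (Real.exp (θ * (j + 1)))) x := by
    filter_upwards [hμ] with x hx
    refine le_trans ?_ (ENNReal.le_tsum ⌊x⌋₊)
    rw [Set.indicator_of_mem (Set.mem_Ici.2 (Nat.floor_le hx))]
    refine ENNReal.ofReal_le_ofReal (Real.exp_le_exp.2 ?_)
    exact mul_le_mul_of_nonneg_left (Nat.lt_floor_add_one x).le hθ
  refine (lintegral_mono_ae hpt).trans ?_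
  rw [lintegral_tsum fun j => (measurable_const.indicator measurableSet_Ici).aemeasurable]
  have hq0 : 0 ≤ Real.exp (-(s - θ)) := (Real.exp_pos _).le
  have hq1 : Real.exp (-(s - θ)) < 1 := Real.exp_lt_one_iff.2 (by linarith)
  have hterm : ∀ j : ℕ, ∫⁻ x, (Set.Ici (j : ℝ)).indicator
      (fun _ => ENNReal.ofReal (Real.exp (θ * (j + 1)))) x ∂μ
      ≤ ENNReal.ofReal (A * Real.exp θ * Real.exp (-(s - θ)) ^ j) := by
    intro j
    rw [lintegral_indicator_const measurableSet_Ici]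
    refine (mul_le_mul_right (h j) _).trans_eq ?_
    rw [← ENNReal.ofReal_mul (Real.exp_pos _).le, ← Real.exp_nat_mul]
    congr 1
    have : Real.exp (θ * (j + 1)) * (A * Real.exp (-(s * j)))
        = A * (Real.exp (θ * (j + 1)) * Real.exp (-(s * j))) := by ring
    rw [this, mul_assoc, ← Real.exp_add, ← Real.exp_add]
    congr 2; ring
  refine (ENNReal.tsum_le_tsum hterm).trans_eq ?_
  rw [← ENNReal.ofReal_tsum_of_nonneg (fun j => by positivity)
    ((summable_geometric_of_lt_one hq0 hq1).mul_left _), tsum_mul_left,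
    tsum_geometric_of_lt_one hq0 hq1, mul_assoc]

/-- Tail bounds `P(S_M ≥ M c) ≤ exp (-M (B + s c))` for all `c ≥ 0` with `B ≤ 0` force
`Λ(θ) ≤ -B` for `0 < θ < s`. -/
lemma cgf_le_of_tail (hν : ∀ᵐ v ∂ν, 0 ≤ v) {s θ B : ℝ} (hθ : 0 < θ) (hs : θ < s)
    (h : ∀ M : ℕ, M ≠ 0 → ∀ c : ℝ, 0 ≤ c →
      convPow ν M (Set.Ici (M * c)) ≤ ENNReal.ofReal (Real.exp (-(M * (B + s * c))))) :
    Integrable (fun v => Real.exp (θ * v)) ν ∧ cgf id ν θ ≤ -B := by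
  set K : ℝ := Real.exp θ * (1 - Real.exp (-(s - θ)))⁻¹
  have hK : 0 < K := mul_pos (Real.exp_pos _)
    (inv_pos.2 (sub_pos.2 (Real.exp_lt_one_iff.2 (by linarith))))
  have hb : ∀ M : ℕ, M ≠ 0 → (∫⁻ v, ENNReal.ofReal (Real.exp (θ * v)) ∂ν) ^ M
      ≤ ENNReal.ofReal (Real.exp (-(M * B)) * K) := by
    intro M hM
    rw [← lintegral_exp_convPow]
    refine lintegral_exp_le_of_tail _ ?_ hθ.le hs (Real.exp_pos _).le fun j => ?_
    · rw [ae_iff]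
      have := (prob_compl_eq_zero_iff (μ := convPow ν M) (measurableSet_Ici (a := (0 : ℝ)))).2
        (convPow_Ici_of_nonpos hν M le_rfl)
      exact this
    · have hM' : (M : ℝ) ≠ 0 := by exact_mod_cast hM
      -- The level `c = j / M` turns the hypothesis into a bound for `P(S_M ≥ j)`.
      have := h M hM (j / M) (by positivity)
      rw [mul_div_cancel₀ _ hM'] at this
      refine this.trans_eq ?_
      rw [← Real.exp_add]
      congr 2
      field_simp
      ring
  have hint : Integrable (fun v => Real.exp (θ * v)) ν := by
    refine ⟨by fun_prop, ?_⟩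
    rw [hasFiniteIntegral_iff_ofReal (ae_of_all _ fun _ => (Real.exp_pos _).le)]
    have := hb 1 one_ne_zero
    rw [pow_one] at this
    exact this.trans_lt ENNReal.ofReal_lt_top
  refine ⟨hint, ?_⟩
  -- `K` does not depend on `M`, so taking `M`-th roots removes it in the limit.
  have hreal : ∀ M : ℕ, M ≠ 0 → cgf id ν θ ≤ -B + Real.log K / M := by
    intro M hM
    have hM' : (0 : ℝ) < M := by positivity
    have := hb M hM
    rw [lintegral_exp_eq_ofReal_exp_cgf hint, ← ENNReal.ofReal_pow (Real.exp_pos _).le,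
      ENNReal.ofReal_le_ofReal_iff (by positivity), ← Real.exp_nat_mul] at this
    have h2 := Real.log_le_log (Real.exp_pos _) this
    rw [Real.log_exp, Real.log_mul (Real.exp_pos _).ne' hK.ne', Real.log_exp] at h2
    rw [← sub_le_iff_le_add', le_div_iff₀ hM']
    linarith
  refine ge_of_tendsto (f := fun M : ℕ => -B + Real.log K / M) (x := atTop) ?_
    ((eventually_ne_atTop 0).mono hreal)
  simpa using (tendsto_const_div_atTop_nhds_zero_nat (Real.log K)).const_add (-B)

/-- The decay rate of the tails is at most the Legendre transform of the cumulant generating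
function. -/
lemma exists_decayRate_le (hν : ∀ᵐ v ∂ν, 0 ≤ v)
    (hmgf : ∃ θ : ℝ, 0 < θ ∧ Integrable (fun v => Real.exp (θ * v)) ν) {a t δ : ℝ} (ha : 0 < a)
    (hat : a < t) (ht : 0 < ν (Set.Ici t)) (hδ : 0 < δ) :
    ∃ θ : ℝ, 0 < θ ∧ Integrable (fun v => Real.exp (θ * v)) ν ∧
      decayRate ν a ≤ θ * a - cgf id ν θ + δ := by
  rcases (decayRate_nonneg (ν := ν) a).eq_or_lt with h0 | hpos
  · obtain ⟨θ, h1, h2, h3⟩ := exists_rate_ge_neg hν hmgf a 1 hδ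
    exact ⟨θ, h1, h2, by linarith⟩
  have hmem0 : 0 < ν (Set.Ici 0) := ht.trans_le (measure_mono (Set.Ici_subset_Ici.2 (by linarith)))
  obtain ⟨s, hs⟩ := exists_subgradient convexOn_decayRate hmem0 ht ha hat
  have hs0 := hs 0 hmem0
  rw [decayRate_zero hν] at hs0
  have hspos : 0 < s := by
    by_contra hneg
    nlinarith
  -- The geometric series needs `θ < s` strictly; the loss `(s - θ) a` is kept below `δ`. Below, `B`
  -- is the intercept of the supporting line at `a`.
  obtain ⟨θ, hθ1, hθ2⟩ := exists_between (max_lt hspos (sub_lt_self s (div_pos hδ ha)))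
  obtain ⟨hθ0, hθ1⟩ := max_lt_iff.1 hθ1
  have hgap : (s - θ) * a < δ := by
    rw [← lt_div_iff₀ ha]; linarith
  obtain ⟨hint, hle⟩ := cgf_le_of_tail (B := decayRate ν a - s * a) hν hθ0 hθ2 fun M hM c _ => by
    by_cases hc : 0 < ν (Set.Ici c)
    · have h1 := convPow_real_le_exp hc hM
      have h2 := hs c hc
      rw [← ENNReal.ofReal_toReal (measure_ne_top (convPow ν M) (Set.Ici (M * c)))]
      refine ENNReal.ofReal_le_ofReal (h1.trans (Real.exp_le_exp.2 ?_))
      have : (M : ℝ) * (decayRate ν a - s * a + s * c) ≤ M * decayRate ν c :=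
        mul_le_mul_of_nonneg_left (by linarith) M.cast_nonneg
      linarith
    · rw [convPow_Ici_eq_zero (by simpa using hc) hM]; exact zero_le
  exact ⟨θ, hθ0, hint, by linarith⟩

end Rates

lemma ereal_exp_neg_mul_le {n G₀ ε y : ℝ} {G : EReal} (hn : 0 ≤ n) (hG : (G₀ : EReal) ≤ G)
    (hy : Real.exp (-(n * (G₀ + ε))) ≤ y) :
    EReal.exp (-((n : EReal) * (G + (ε : EReal)))) ≤ ENNReal.ofReal y := by
  refine le_trans (EReal.exp_monotone (b := ((-(n * (G₀ + ε)) : ℝ) : EReal)) ?_) ?_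
  · rw [EReal.coe_neg, EReal.neg_le_neg_iff, EReal.coe_mul, EReal.coe_add]
    exact mul_le_mul_of_nonneg_left (by gcongr) (by exact_mod_cast hn)
  · rw [EReal.exp_coe]; exact ENNReal.ofReal_le_ofReal hy

/-! ### Cramér's lower bound, uniform in the level -/

section Cramer

variable {ν : Measure ℝ} [IsProbabilityMeasure ν]

/-- If `V ≤ a` almost surely, then `θ a - Λ(θ)` comes close to `-log P(V = a)`. -/
lemma exists_rate_ge_neg_log {a q : ℝ} (ha : ν (Set.Ioi a) = 0) (hq : ν.real (Set.Ici a) < q) :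
    ∃ θ : ℝ, 0 < θ ∧ Integrable (fun v => Real.exp (θ * v)) ν ∧
      -Real.log q ≤ θ * a - cgf id ν θ := by
  have hle : ∀ᵐ v ∂ν, v ≤ a := by rw [ae_iff]; simpa [Set.Ioi] using ha
  have hint : ∀ θ : ℝ, 0 ≤ θ → Integrable (fun v => Real.exp (θ * v)) ν := fun θ hθ =>
    integrable_exp_mul_of_le θ a hθ aemeasurable_id hle
  -- `exp (n (v - a))` decreases to the indicator of `v = a` on `v ≤ a`; a large integer is taken as
  -- `θ`.
  have hlim : Tendsto (fun n : ℕ => ∫ v, Real.exp (n * (v - a)) ∂ν) atTop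
      (nhds (∫ v, (Set.Ici a).indicator (fun _ => (1 : ℝ)) v ∂ν)) := by
    refine tendsto_integral_of_dominated_convergence (fun _ => 1) (fun n => by fun_prop)
      (integrable_const 1) (fun n => ?_) ?_
    · filter_upwards [hle] with v hv
      rw [Real.norm_of_nonneg (Real.exp_pos _).le, Real.exp_le_one_iff]
      exact mul_nonpos_of_nonneg_of_nonpos n.cast_nonneg (by linarith)
    · filter_upwards [hle] with v hv
      rcases hv.eq_or_lt with rfl | hv
      · simp
      · rw [Set.indicator_of_notMem (by simpa using hv)]
        refine Real.tendsto_exp_atBot.comp ?_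
        exact tendsto_natCast_atTop_atTop.atTop_mul_const_of_neg (by linarith)
  rw [integral_indicator_const _ measurableSet_Ici, smul_eq_mul, mul_one] at hlim
  obtain ⟨n, hn, hn0⟩ := ((hlim.eventually (gt_mem_nhds hq)).and (eventually_ne_atTop 0)).exists
  have hn0' : (0 : ℝ) < n := by positivity
  refine ⟨n, hn0', hint n hn0'.le, ?_⟩
  have hm : mgf id ν n = Real.exp (n * a) * ∫ v, Real.exp (n * (v - a)) ∂ν := by
    rw [mgf, ← integral_const_mul]
    refine integral_congr_ae (ae_of_all _ fun v => ?_)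
    simp only [id]
    rw [← Real.exp_add]; congr 1; ring
  have hpos : 0 < mgf id ν n := mgf_pos (hint n hn0'.le)
  have hpos' : 0 < ∫ v, Real.exp (n * (v - a)) ∂ν := by
    rw [hm] at hpos; exact pos_of_mul_pos_right hpos (Real.exp_pos _).le
  rw [cgf, hm, Real.log_mul (Real.exp_pos _).ne' hpos'.ne', Real.log_exp]
  have := Real.log_le_log hpos' hn.le
  linarith

/-- By convexity the slope over `[a, a']` is at most that over `[a', t]`, which is bounded because
the rate is nonnegative and `t - a' ≥ t - τ`. -/
lemma decayRate_le_add {a a' τ t : ℝ} (haa : a ≤ a') (ha' : a' ≤ τ) (hτ : τ < t)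
    (ht : 0 < ν (Set.Ici t)) :
    decayRate ν a' ≤ decayRate ν a + decayRate ν t / (t - τ) * (a' - a) := by
  rcases haa.eq_or_lt with rfl | haa
  · simp
  have hmem : 0 < ν (Set.Ici a) := ht.trans_le (measure_mono (Set.Ici_subset_Ici.2 (by linarith)))
  have h1 := convexOn_decayRate.slope_mono_adjacent hmem ht haa (ha'.trans_lt hτ)
  have h2 : (decayRate ν t - decayRate ν a') / (t - a') ≤ decayRate ν t / (t - τ) :=
    div_le_div₀ (decayRate_nonneg t) (by linarith [decayRate_nonneg (ν := ν) a']) (by linarith)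
      (by linarith)
  have h3 := (div_le_iff₀ (sub_pos.2 haa)).1 (h1.trans h2)
  linarith

/-- Round `a` up to a grid of mesh `δ`. Convergence on the finite grid, the Lipschitz error of
rounding and the choice of `θ` cost `ε / 3` each. -/
lemma cramer_uniform_of_lt (hν : ∀ᵐ v ∂ν, 0 ≤ v)
    (hmgf : ∃ θ : ℝ, 0 < θ ∧ Integrable (fun v => Real.exp (θ * v)) ν) {τ t ε : ℝ} (hτ : τ < t)
    (ht : 0 < ν (Set.Ici t)) (hε : 0 < ε) :
    ∃ M₀ : ℕ, ∀ M, M₀ ≤ M → ∀ a, 0 < a → a ≤ τ →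
      ∃ θ : ℝ, 0 < θ ∧ Integrable (fun v => Real.exp (θ * v)) ν ∧
        Real.exp (-(M * (θ * a - cgf id ν θ + ε))) ≤ (convPow ν M).real (Set.Ici (M * a)) := by
  obtain ⟨τ₁, hτ₁, hτ₁t⟩ := exists_between hτ
  set K := decayRate ν t / (t - τ₁)
  have hK : 0 ≤ K := div_nonneg (decayRate_nonneg t) (by linarith)
  obtain ⟨δ, hδ, hδ'⟩ : ∃ δ, 0 < δ ∧ δ < min (τ₁ - τ) (ε / 3 / (K + 1)) :=
    exists_between (lt_min (by linarith) (by positivity))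
  obtain ⟨hδ1, hδ2⟩ := lt_min_iff.1 hδ'
  rw [lt_div_iff₀ (by linarith)] at hδ2
  have hev : ∀ᶠ M : ℕ in atTop, ∀ j ∈ Finset.range (⌈τ / δ⌉₊ + 1), j * δ < t →
      negLogTail ν (j * δ) M / M < decayRate ν (j * δ) + ε / 3 := by
    rw [eventually_all_finset]
    intro j _
    by_cases hj : j * δ < t
    · have hj' : 0 < ν (Set.Ici (j * δ)) :=
        ht.trans_le (measure_mono (Set.Ici_subset_Ici.2 hj.le))
      filter_upwards [(tendsto_negLogTail_div hj').eventually
        (gt_mem_nhds (show _ < decayRate ν (j * δ) + ε / 3 by linarith))] with M hM _ using hM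
    · exact Eventually.of_forall fun _ h => absurd h hj
  obtain ⟨M₀, hM₀⟩ := eventually_atTop.1 hev
  refine ⟨max M₀ 1, fun M hM a ha haτ => ?_⟩
  have hM' : (0 : ℝ) < M := by
    have : 1 ≤ M := (le_max_right _ _).trans hM
    positivity
  have haj : a ≤ ⌈a / δ⌉₊ * δ := by
    rw [← div_le_iff₀ hδ]; exact Nat.le_ceil _
  have hja : ⌈a / δ⌉₊ * δ < a + δ := by
    have := Nat.ceil_lt_add_one (a := a / δ) (by positivity)
    have h2 := mul_lt_mul_of_pos_right this hδ
    rwa [add_mul, div_mul_cancel₀ _ hδ.ne', one_mul] at h2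
  have hj := hM₀ M ((le_max_left _ _).trans hM) ⌈a / δ⌉₊
    (Finset.mem_range.2 (Nat.lt_succ_of_le (Nat.ceil_mono (by gcongr)))) (by linarith)
  rw [div_lt_iff₀ hM'] at hj
  have hpos : 0 < ν (Set.Ici (⌈a / δ⌉₊ * δ)) :=
    ht.trans_le (measure_mono (Set.Ici_subset_Ici.2 (by linarith)))
  have hlip := decayRate_le_add haj (by linarith) hτ₁t ht
  have hKδ : K * (⌈a / δ⌉₊ * δ - a) ≤ ε / 3 := by nlinarith
  obtain ⟨θ, hθ, hint, hrate⟩ := exists_decayRate_le hν hmgf ha (haτ.trans_lt hτ) ht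
    (show 0 < ε / 3 by linarith)
  refine ⟨θ, hθ, hint, ?_⟩
  calc Real.exp (-(M * (θ * a - cgf id ν θ + ε)))
      ≤ Real.exp (-negLogTail ν (⌈a / δ⌉₊ * δ) M) := by
        refine Real.exp_le_exp.2 (neg_le_neg (hj.le.trans ?_))
        rw [mul_comm]
        exact mul_le_mul_of_nonneg_left (by linarith) hM'.le
    _ = (convPow ν M).real (Set.Ici (M * (⌈a / δ⌉₊ * δ))) := by
        rw [negLogTail, neg_neg, Real.exp_log (convPow_real_pos hpos M)]
    _ ≤ _ := measureReal_mono (Set.Ici_subset_Ici.2 (by gcongr))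

/-- Cramér's lower bound, uniformly for all `0 < a ≤ τ`, if `P(V ≥ τ) > 0`. -/
theorem cramer_uniform (hν : ∀ᵐ v ∂ν, 0 ≤ v)
    (hmgf : ∃ θ : ℝ, 0 < θ ∧ Integrable (fun v => Real.exp (θ * v)) ν) {τ ε : ℝ}
    (hτ : 0 < ν (Set.Ici τ)) (hε : 0 < ε) :
    ∃ M₀ : ℕ, ∀ M, M₀ ≤ M → ∀ a, 0 < a → a ≤ τ →
      ∃ θ : ℝ, 0 < θ ∧ Integrable (fun v => Real.exp (θ * v)) ν ∧
        Real.exp (-(M * (θ * a - cgf id ν θ + ε))) ≤ (convPow ν M).real (Set.Ici (M * a)) := by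
  by_cases hex : ∃ t, τ < t ∧ 0 < ν (Set.Ici t)
  · obtain ⟨t, hτt, ht⟩ := hex
    exact cramer_uniform_of_lt hν hmgf hτt ht hε
  push Not at hex
  -- Now `τ` is the maximum of `V`, attained with positive probability.
  have hnull : ν (Set.Ioi τ) = 0 := by
    obtain ⟨u, -, hu, hlim⟩ := exists_seq_strictAnti_tendsto τ
    refine measure_mono_null (t := ⋃ n, Set.Ici (u n)) (fun v hv => ?_)
      (measure_iUnion_null fun n => nonpos_iff_eq_zero.1 (hex _ (hu n)))
    obtain ⟨n, hn⟩ := (hlim.eventually (gt_mem_nhds (Set.mem_Ioi.1 hv))).exists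
    exact Set.mem_iUnion.2 ⟨n, hn.le⟩
  have hp : 0 < ν.real (Set.Ici τ) := ENNReal.toReal_pos hτ.ne' (measure_ne_top _ _)
  obtain ⟨θ₁, hθ₁, hint₁, hrate₁⟩ := exists_rate_ge_neg_log
    (q := ν.real (Set.Ici τ) * Real.exp (ε / 2)) hnull
    (lt_mul_of_one_lt_right hp (Real.one_lt_exp_iff.2 (by linarith)))
  rw [Real.log_mul hp.ne' (Real.exp_pos _).ne', Real.log_exp] at hrate₁
  -- Above this cutoff, replacing `τ` by `a` costs at most `ε / 2` in `θ₁ a`, and the event that all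
  -- summands are at least `τ` suffices.
  obtain ⟨M₀, hM₀⟩ := cramer_uniform_of_lt (τ := τ - ε / 2 / θ₁) hν hmgf
    (sub_lt_self τ (by positivity)) hτ hε
  refine ⟨M₀, fun M hM a ha haτ => ?_⟩
  rcases le_or_gt a (τ - ε / 2 / θ₁) with h | h
  · exact hM₀ M hM a ha h
  refine ⟨θ₁, hθ₁, hint₁, ?_⟩
  have h1 : θ₁ * τ - ε / 2 ≤ θ₁ * a := by
    have := mul_lt_mul_of_pos_left h hθ₁
    rw [mul_sub, mul_div_cancel₀ _ hθ₁.ne'] at this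
    exact this.le
  calc Real.exp (-(M * (θ₁ * a - cgf id ν θ₁ + ε)))
      ≤ Real.exp (M * Real.log (ν.real (Set.Ici τ))) := by
        refine Real.exp_le_exp.2 ?_
        rw [← mul_neg]
        exact mul_le_mul_of_nonneg_left (by linarith) M.cast_nonneg
    _ = ν.real (Set.Ici τ) ^ M := by rw [Real.exp_nat_mul, Real.exp_log hp]
    _ ≤ (convPow ν M).real (Set.Ici (M * τ)) := by
        rw [measureReal_def, measureReal_def, ← ENNReal.toReal_pow]
        exact ENNReal.toReal_mono (measure_ne_top _ _) (pow_le_convPow ν M τ)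
    _ ≤ _ := measureReal_mono (Set.Ici_subset_Ici.2 (by gcongr))

/-- The lower bound for `P(S_M ≥ n z)`, uniformly in the number `M ≤ C n` of summands with
`z ≤ (M / n) τ`. The value `G` stands for a rate that dominates `θ z - (M / n) Λ(θ)` for all
`θ > 0`. -/
theorem exp_rate_le_convPow (hν : ∀ᵐ v ∂ν, 0 ≤ v)
    (hmgf : ∃ θ : ℝ, 0 < θ ∧ Integrable (fun v => Real.exp (θ * v)) ν) {τ : ℝ}
    (hτ : 0 < ν (Set.Ici τ)) (z : ℝ) {C ε : ℝ} (hC : 0 < C) (hε : 0 < ε) :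
    ∃ n₀ : ℕ, ∀ n : ℕ, n₀ ≤ n → ∀ M : ℕ, (M : ℝ) ≤ C * n → n * z ≤ M * τ → ∀ G : EReal,
      (∀ θ : ℝ, 0 < θ → Integrable (fun v => Real.exp (θ * v)) ν →
        ((θ * z - M / n * cgf id ν θ : ℝ) : EReal) ≤ G) →
      EReal.exp (-(((n : ℝ) : EReal) * (G + (ε : EReal)))) ≤ convPow ν M (Set.Ici (n * z)) := by
  rcases le_or_gt z 0 with hz | hz
  · refine ⟨0, fun n _ M _ _ G hG => ?_⟩
    rw [convPow_Ici_of_nonpos hν M (mul_nonpos_of_nonneg_of_nonpos n.cast_nonneg hz),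
      ← ENNReal.ofReal_one]
    obtain ⟨θ, h1, h2, h3⟩ := exists_rate_ge_neg hν hmgf z (M / n) hε
    refine ereal_exp_neg_mul_le n.cast_nonneg (hG θ h1 h2) ?_
    rw [Real.exp_le_one_iff, neg_nonpos]
    exact mul_nonneg n.cast_nonneg (by linarith)
  obtain ⟨M₀, hM₀⟩ := cramer_uniform hν hmgf hτ (div_pos hε hC)
  -- For such `n`, `n z ≤ M τ` forces `M ≥ M₀`. The error `ε / C` per summand totals at most `n ε`.
  refine ⟨max 1 ⌈M₀ * τ / z⌉₊, fun n hn M hMC hMτ G hG => ?_⟩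
  have hn0 : (0 : ℝ) < n := by
    have : 1 ≤ n := (le_max_left _ _).trans hn
    positivity
  have hpos : 0 < (M : ℝ) * τ := (mul_pos hn0 hz).trans_le hMτ
  have hM : (0 : ℝ) < M := by
    rcases (Nat.cast_nonneg M : (0 : ℝ) ≤ M).eq_or_lt with h | h
    · rw [← h, zero_mul] at hpos; exact absurd hpos (lt_irrefl _)
    · exact h
  have hτ0 : 0 < τ := pos_of_mul_pos_right hpos hM.le
  have hMM : M₀ ≤ M := by
    have h1 : M₀ * τ / z ≤ n := (Nat.le_ceil _).trans (by exact_mod_cast (le_max_right _ _).trans hn)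
    rw [div_le_iff₀ hz] at h1
    have h2 := le_of_mul_le_mul_right (h1.trans hMτ) hτ0
    exact_mod_cast h2
  obtain ⟨θ, hθ, hint, hbound⟩ := hM₀ M hMM (n * z / M) (by positivity)
    (by rw [div_le_iff₀ hM]; linarith)
  rw [mul_div_cancel₀ _ hM.ne'] at hbound
  rw [← ENNReal.ofReal_toReal (measure_ne_top (convPow ν M) _)]
  refine ereal_exp_neg_mul_le n.cast_nonneg (hG θ hθ hint) (le_trans (Real.exp_le_exp.2 ?_) hbound)
  have h1 : (M : ℝ) * (ε / C) ≤ n * ε := by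
    rw [mul_div_assoc', div_le_iff₀ hC]; nlinarith
  have h2 : (M : ℝ) * (θ * (n * z / M)) = n * (θ * z) := by field_simp
  have h3 : (n : ℝ) * (M / n * cgf id ν θ) = M * cgf id ν θ := by field_simp
  nlinarith

/-- A rate that dominates `θ z - r Λ(θ)` for all `θ > 0` is infinite if `P(r V ≥ z) = 0`. -/
lemma rate_eq_top {z r : ℝ} (hr : 0 < r) (h : ν (Set.Ici (z / r)) = 0) {G : EReal}
    (hG : ∀ θ : ℝ, 0 < θ → Integrable (fun v => Real.exp (θ * v)) ν →
      ((θ * z - r * cgf id ν θ : ℝ) : EReal) ≤ G) : G = ⊤ := by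
  rw [EReal.eq_top_iff_forall_lt]
  intro y
  obtain ⟨θ, hθ, hint, hle⟩ := exists_rate_ge_neg_log (q := Real.exp (-((y + 1) / r)))
    (measure_mono_null Set.Ioi_subset_Ici_self h)
    (by rw [measureReal_def, h]; exact Real.exp_pos _)
  refine lt_of_lt_of_le (EReal.coe_lt_coe_iff.2 ?_) (hG θ hθ hint)
  rw [Real.log_exp, neg_neg, div_le_iff₀ hr] at hle
  have : (θ * (z / r) - cgf id ν θ) * r = θ * z - r * cgf id ν θ := by field_simp
  linarith

end Cramer

/-! ### Pathwise lower bounds for departures and peak ages -/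

section Queue

variable {η : ℕ} (d N : Fin η → ℕ) (b : ℝ)

/-- The packets served in round `r`, in the order of service. -/
def roundPackets (r : ℕ) : List (Packet N) := (roundList d N r).map (packetIn d N r)

/-- The packets of the `c` rounds before round `d_g (k - 1)`, followed by those of this round up to
the `k`-th packet of `s`. -/
def recentPackets (s : Source N) (k c : ℕ) : List (Packet N) :=
  (List.range' (d s.1 * (k - 1) - c) c).flatMap (roundPackets d N) ++ Jminus d N s k

variable {d N}

lemma mem_roundList {r : ℕ} {s : Source N} : s ∈ roundList d N r ↔ d s.1 ∣ r := by
  obtain ⟨g, i⟩ := s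
  simp only [roundList, List.mem_flatMap, List.mem_filter, List.mem_finRange, true_and,
    decide_eq_true_eq, List.mem_map, Sigma.mk.injEq]
  constructor
  · rintro ⟨g', hg', i', rfl, -⟩; exact hg'
  · intro h; exact ⟨g, h, i, rfl, HEq.rfl⟩

lemma nodup_roundList (r : ℕ) : (roundList d N r).Nodup := by
  rw [roundList, List.nodup_flatMap]
  refine ⟨fun g _ => (List.nodup_finRange _).map fun i j h => by simpa using h, ?_⟩
  refine ((List.nodup_finRange η).filter _).imp fun {g g'} hne => ?_
  simp only [Function.onFun]
  rw [List.disjoint_left]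
  intro s hs hs'
  obtain ⟨i, -, rfl⟩ := List.mem_map.1 hs
  obtain ⟨i', -, h⟩ := List.mem_map.1 hs'
  exact hne (Sigma.mk.inj_iff.1 h).1.symm

lemma length_roundList (r : ℕ) :
    (roundList d N r).length = ∑ g, if d g ∣ r then N g else 0 := by
  have : ∀ l : List (Fin η), ((l.filter fun g => d g ∣ r).flatMap fun g =>
      (List.finRange (N g)).map fun i => (⟨g, i⟩ : Source N)).length
      = (l.map fun g => if d g ∣ r then N g else 0).sum := by
    intro l
    induction l with
    | nil => simp
    | cons g l ih => by_cases h : d g ∣ r <;> simp [h, ih]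
  rw [roundList, this, ← List.ofFn_eq_map, List.sum_ofFn]

/-- The round of a packet. -/
lemma eq_round_of_mem {r : ℕ} {p : Packet N} (hp : p ∈ roundPackets d N r) :
    d p.1.1 * (p.2 - 1) = r := by
  obtain ⟨s, hs, rfl⟩ := List.mem_map.1 hp
  simpa [packetIn] using Nat.mul_div_cancel' (mem_roundList.1 hs)

lemma arrival_of_mem {r : ℕ} {p : Packet N} (hp : p ∈ roundPackets d N r) :
    arrival d N b p.1.1 p.2 = r * (numSources N * b) := by
  obtain ⟨s, hs, rfl⟩ := List.mem_map.1 hp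
  have h : ((d s.1 * (r / d s.1) : ℕ) : ℝ) = r := by
    rw [Nat.mul_div_cancel' (mem_roundList.1 hs)]
  rw [arrival, packetIn, ← h]
  push_cast
  ring

lemma nodup_roundPackets (r : ℕ) : (roundPackets d N r).Nodup :=
  (nodup_roundList r).map fun _ _ h => (Prod.mk.inj h).1

lemma Jminus_sublist (s : Source N) (k : ℕ) :
    (Jminus d N s k).Sublist (roundPackets d N (d s.1 * (k - 1))) :=
  List.filter_sublist.map _

lemma packetIn_mem_Jminus (s : Source N) (k : ℕ) :
    packetIn d N (d s.1 * (k - 1)) s ∈ Jminus d N s k := by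
  refine List.mem_map.2 ⟨s, List.mem_filter.2 ⟨mem_roundList.2 (dvd_mul_right _ _), ?_⟩, rfl⟩
  simp [Upto]

/-- A packet determines its round, so nothing repeats; this is what makes the service times
independent. -/
lemma nodup_recentPackets (s : Source N) (k : ℕ) {c : ℕ} (hc : c ≤ d s.1 * (k - 1)) :
    (recentPackets d N s k c).Nodup := by
  rw [recentPackets, List.nodup_append']
  refine ⟨?_, (nodup_roundPackets _).sublist (Jminus_sublist s k), ?_⟩
  · rw [List.nodup_flatMap]
    refine ⟨fun r _ => nodup_roundPackets r, (List.nodup_range' 1).imp fun {r r'} hne => ?_⟩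
    simp only [Function.onFun]
    rw [List.disjoint_left]
    exact fun p hp hp' => hne ((eq_round_of_mem hp).symm.trans (eq_round_of_mem hp'))
  · rw [List.disjoint_left]
    intro p hp hp'
    obtain ⟨r, hr, hpr⟩ := List.mem_flatMap.1 hp
    have h1 := (eq_round_of_mem hpr).symm.trans
      (eq_round_of_mem ((Jminus_sublist s k).subset hp'))
    have h2 := (List.mem_range'_1.1 hr).2
    omega

variable (V : Packet N → ℝ)

lemma add_sum_le_serveAll (t : ℝ) (l : List (Packet N)) :
    t + (l.map V).sum ≤ serveAll d N b V t l := by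
  induction l generalizing t with
  | nil => simp [serveAll]
  | cons p l ih =>
    have := ih (max t (arrival d N b p.1.1 p.2) + V p)
    simp only [serveAll, List.foldl_cons, List.map_cons, List.sum_cons] at *
    linarith [le_max_left t (arrival d N b p.1.1 p.2)]

lemma arrival_add_sum_le_serveAll (t : ℝ) {A : ℝ} {l : List (Packet N)} (hl : l ≠ [])
    (hA : ∀ p ∈ l, A ≤ arrival d N b p.1.1 p.2) : A + (l.map V).sum ≤ serveAll d N b V t l := by
  cases l with
  | nil => exact absurd rfl hl
  | cons p l =>
    have := add_sum_le_serveAll (d := d) b V (max t (arrival d N b p.1.1 p.2) + V p) l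
    simp only [serveAll, List.foldl_cons, List.map_cons, List.sum_cons] at *
    linarith [le_max_right t (arrival d N b p.1.1 p.2), hA p (by simp)]

lemma le_roundStart {r : ℕ} (hr : roundPackets d N r ≠ []) (c : ℕ) :
    r * (numSources N * b) + (((List.range' r (c + 1)).flatMap (roundPackets d N)).map V).sum
      ≤ roundStart d N b V (r + (c + 1)) := by
  induction c with
  | zero =>
    simp only [zero_add, List.range'_one, List.flatMap_cons, List.flatMap_nil, List.append_nil]
    exact arrival_add_sum_le_serveAll b V _ hr fun p hp => (arrival_of_mem b hp).ge
  | succ c ih =>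
    rw [List.range'_concat, List.flatMap_append, List.map_append, List.sum_append, ← add_assoc]
    refine (add_le_add_left ih _).trans ?_
    simp only [one_mul, List.flatMap_cons, List.flatMap_nil, List.append_nil]
    exact add_sum_le_serveAll b V _ _

lemma le_departure (s : Source N) (k : ℕ) {c : ℕ} (hc : c ≤ d s.1 * (k - 1)) (hdc : d s.1 ∣ c) :
    ((d s.1 * (k - 1) - c : ℕ) : ℝ) * (numSources N * b) + ((recentPackets d N s k c).map V).sum
      ≤ departure d N b V s k := by
  rw [recentPackets, departure]
  cases c with
  | zero =>
    simp only [List.range'_zero, List.flatMap_nil, List.nil_append, Nat.sub_zero]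
    refine arrival_add_sum_le_serveAll b V _ (List.ne_nil_of_mem (packetIn_mem_Jminus s k))
      fun p hp => (arrival_of_mem b ((Jminus_sublist s k).subset hp)).ge
  | succ c =>
    rw [List.map_append, List.sum_append, ← add_assoc]
    have hne : roundPackets d N (d s.1 * (k - 1) - (c + 1)) ≠ [] :=
      List.ne_nil_of_mem (List.mem_map.2
        ⟨s, mem_roundList.2 (Nat.dvd_sub (dvd_mul_right _ _) hdc), rfl⟩)
    have h := le_roundStart b V hne c
    rw [Nat.sub_add_cancel hc] at h
    exact (add_le_add_left h _).trans (add_sum_le_serveAll b V _ _)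

lemma le_peakAge (s : Source N) {k : ℕ} (hk : 0 < k) {c : ℕ} (hc : c ≤ d s.1 * (k - 1))
    (hdc : d s.1 ∣ c) :
    numSources N * ((d s.1 - c : ℝ) * b) + ((recentPackets d N s k c).map V).sum
      ≤ peakAge d N b V s k := by
  have h := le_departure b V s k hc hdc
  rw [peakAge, arrival]
  rw [Nat.cast_sub hc] at h
  push_cast [Nat.cast_sub (show 1 ≤ k from hk)] at h ⊢
  linarith

end Queue

/-! ### Numbers of packets -/

section Counting

variable {η : ℕ} {d N : Fin η → ℕ}

lemma dTilde_pos (hd : ∀ j, 0 < d j) : 0 < dTilde d :=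
  Nat.pos_of_ne_zero fun h => by
    rw [dTilde, Finset.lcm_eq_zero_iff] at h
    obtain ⟨j, -, hj⟩ := h
    exact (hd j).ne' hj

lemma dvd_dTilde (j : Fin η) : d j ∣ dTilde d := Finset.dvd_lcm (Finset.mem_univ j)

lemma card_filter_dvd_Ico {a m : ℕ} (ha : 0 < a) (ham : a ∣ m) (r : ℕ) :
    ((Finset.Ico r (r + m)).filter (a ∣ ·)).card = m / a := by
  obtain ⟨q, rfl⟩ := ham
  rw [Nat.mul_div_cancel_left q ha]
  have hper : Function.Periodic (fun j => a ∣ j) (a * q) := fun j => by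
    simp [Nat.dvd_add_left (dvd_mul_right a q)]
  rw [Nat.filter_Ico_card_eq_of_periodic r (a * q) _ hper, Nat.count_eq_card_filter_range]
  have : (Finset.range (a * q)).filter (a ∣ ·) = (Finset.range q).image (a * ·) := by
    ext j
    simp only [Finset.mem_filter, Finset.mem_range, Finset.mem_image]
    constructor
    · rintro ⟨hj, i, rfl⟩; exact ⟨i, lt_of_mul_lt_mul_left hj a.zero_le, rfl⟩
    · rintro ⟨i, hi, rfl⟩; exact ⟨Nat.mul_lt_mul_of_pos_left hi ha, dvd_mul_right _ _⟩
  rw [this, Finset.card_image_of_injective _ (fun _ _ h => Nat.eq_of_mul_eq_mul_left ha h), Finset.card_range]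

lemma length_flatMap_roundPackets (r c : ℕ) :
    ((List.range' r c).flatMap (roundPackets d N)).length
      = ∑ j, N j * ((Finset.Ico r (r + c)).filter (d j ∣ ·)).card := by
  induction c with
  | zero => simp
  | succ c ih =>
    rw [List.range'_concat, List.flatMap_append, List.length_append, ih]
    simp only [one_mul, List.flatMap_cons, List.flatMap_nil, List.append_nil, roundPackets,
      List.length_map, length_roundList]
    rw [← Finset.sum_add_distrib]
    refine Finset.sum_congr rfl fun j _ => ?_
    rw [← add_assoc, ← Finset.insert_Ico_right_eq_Ico_add_one (Nat.le_add_right r c),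
      Finset.filter_insert]
    split_ifs with h
    · rw [Finset.card_insert_of_notMem (by simp)]; ring
    · simp

/-- Any `q d̃` consecutive rounds contain exactly `q d̃ / d_j` multiples of `d_j`, wherever they
begin. -/
lemma length_recentPackets (hd : ∀ j, 0 < d j) (hN : 0 < numSources N) (s : Source N) (k q : ℕ) :
    ((recentPackets d N s k (q * dTilde d)).length : ℝ)
      = numSources N * (q * loadRatio d N + mRatio d N s k) := by
  have hn : (numSources N : ℝ) ≠ 0 := by positivity
  rw [recentPackets, List.length_append, length_flatMap_roundPackets, Nat.cast_add, mul_add,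
    mRatio, mul_div_cancel₀ _ hn, loadRatio]
  congr 1
  push_cast
  rw [Finset.mul_sum, Finset.mul_sum]
  refine Finset.sum_congr rfl fun j _ => ?_
  rw [card_filter_dvd_Ico (hd j) ((dvd_dTilde j).mul_left q),
    Nat.cast_div ((dvd_dTilde j).mul_left q) (by exact_mod_cast (hd j).ne')]
  push_cast
  field_simp

lemma one_le_loadRatio (hd : ∀ j, 0 < d j) (hN : 0 < numSources N) : 1 ≤ loadRatio d N := by
  have hn : (0 : ℝ) < numSources N := by exact_mod_cast hN
  have h1 : ∑ j, (N j : ℝ) / numSources N = 1 := by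
    rw [← Finset.sum_div, ← Nat.cast_sum]; exact div_self hn.ne'
  rw [← h1]
  refine Finset.sum_le_sum fun j _ => le_mul_of_one_le_left (by positivity) ?_
  rw [one_le_div (by exact_mod_cast hd j)]
  exact_mod_cast Nat.le_of_dvd (dTilde_pos hd) (dvd_dTilde j)

lemma loadRatio_le (hd : ∀ j, 0 < d j) (hN : 0 < numSources N) : loadRatio d N ≤ dTilde d := by
  have hn : (0 : ℝ) < numSources N := by exact_mod_cast hN
  have h1 : ∑ j, (N j : ℝ) / numSources N = 1 := by
    rw [← Finset.sum_div, ← Nat.cast_sum]; exact div_self hn.ne'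
  rw [← mul_one (dTilde d : ℝ), ← h1, Finset.mul_sum]
  refine Finset.sum_le_sum fun j _ => mul_le_mul_of_nonneg_right ?_ (by positivity)
  exact div_le_self (by positivity) (by exact_mod_cast hd j)

lemma mRatio_pos (hN : 0 < numSources N) (s : Source N) (k : ℕ) : 0 < mRatio d N s k :=
  div_pos (by exact_mod_cast List.length_pos_of_mem (packetIn_mem_Jminus s k))
    (by exact_mod_cast hN)

lemma mRatio_le_one (hN : 0 < numSources N) (s : Source N) (k : ℕ) : mRatio d N s k ≤ 1 := by
  rw [mRatio, div_le_one (by exact_mod_cast hN)]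
  norm_cast
  refine (Jminus_sublist s k).length_le.trans ?_
  rw [roundPackets, List.length_map, length_roundList]
  exact Finset.sum_le_sum fun j _ => by split_ifs <;> omega

end Counting

/-! ### From the queue to sums, and the rates of the theorem -/

/-- The violation probability is at least the probability that the packets served in the last `q`
iterations and in the current round take long enough. -/
theorem convPow_le_measure_peakAge {η : ℕ} {d N : Fin η → ℕ} {b : ℝ} {ν : Measure ℝ}
    [IsProbabilityMeasure ν] {Ω : Type u} [MeasurableSpace Ω] {P : Measure Ω}
    [IsProbabilityMeasure P] {V : Packet N → Ω → ℝ} (hV : ∀ p, HasLaw (V p) ν P)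
    (hi : iIndepFun V P) (s : Source N) {k : ℕ} (hk : 0 < k) (x : ℝ) {q : ℕ}
    (hq : q * dTilde d ≤ d s.1 * (k - 1)) :
    convPow ν (recentPackets d N s k (q * dTilde d)).length
        (Set.Ici (numSources N * (x + (q * dTilde d - d s.1) * b)))
      ≤ P {ω | numSources N * x ≤ peakAge d N b (fun p => V p ω) s k} := by
  have hlaw := hasLaw_list_sum ν hV hi _ (nodup_recentPackets s k hq)
  refine (hlaw.measure_eq (p := fun y => numSources N * (x + (q * dTilde d - d s.1) * b) ≤ y)
    measurableSet_Ici).symm.trans_le ?_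
  refine measure_mono fun ω hω => ?_
  have h := le_peakAge b (fun p => V p ω) s hk hq ((dvd_dTilde s.1).mul_left q)
  simp only [Set.mem_ofPred_eq] at hω ⊢
  push_cast at h
  refine le_trans ?_ h
  linarith

/-- `G` is at least `θ z - r Λ(θ)` for every `θ > 0` with `Λ(θ) < ∞`. -/
def DominatesRate (ν : Measure ℝ) (r z : ℝ) (G : EReal) : Prop :=
  ∀ θ : ℝ, 0 < θ → Integrable (fun v => Real.exp (θ * v)) ν →
    ((θ * z - r * cgf id ν θ : ℝ) : EReal) ≤ G

lemma DominatesRate.mono {ν : Measure ℝ} {r z z' : ℝ} {G : EReal} (h : DominatesRate ν r z G)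
    (hz : z' ≤ z) : DominatesRate ν r z' G := fun θ hθ hint =>
  le_trans (EReal.coe_le_coe_iff.2 (by gcongr)) (h θ hθ hint)

section Rates

variable {ν : Measure ℝ} [IsProbabilityMeasure ν]

lemma dominatesRate_rateZero (r z : ℝ) : DominatesRate ν r z (rateZero ν r z) := by
  intro θ hθ hint
  refine le_iSup_of_le ⟨θ, hθ⟩ ?_
  rw [logMGF_eq_cgf hint, EReal.coe_sub, EReal.coe_mul r]

lemma rateZero_le {r z : ℝ} (hr : 0 < r) {G : EReal} (h : DominatesRate ν r z G) :
    rateZero ν r z ≤ G := by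
  refine iSup_le fun ⟨θ, hθ⟩ => ?_
  by_cases hint : Integrable (fun v => Real.exp (θ * v)) ν
  · rw [logMGF_eq_cgf hint, ← EReal.coe_mul, ← EReal.coe_sub]
    exact h θ hθ hint
  · have htop : ∫⁻ v, ENNReal.ofReal (Real.exp (θ * v)) ∂ν = ⊤ := by
      by_contra hne
      refine hint ⟨by fun_prop, ?_⟩
      rw [hasFiniteIntegral_iff_ofReal (ae_of_all _ fun _ => (Real.exp_pos _).le)]
      exact lt_top_iff_ne_top.2 hne
    rw [logMGF, htop, ENNReal.log_top, EReal.coe_mul_top_of_pos hr, EReal.sub_top]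
    exact bot_le

lemma dominatesRate_gammaL_zero {η : ℕ} {d N : Fin η → ℕ} {b : ℝ} (s : Source N) (k : ℕ) (x : ℝ) :
    DominatesRate ν (mRatio d N s k) (x - d s.1 * b) (gammaL d N b ν s k x 0) := by
  rw [gammaL, if_pos rfl]; exact dominatesRate_rateZero _ _

/-- The factor `ℓ' = q + 1` clears the denominators. What remains is the load of `q` iterations with
a threshold exceeding that of `convPow_le_measure_peakAge` by `d̃ b`. -/
lemma dominatesRate_gammaL_succ {η : ℕ} {d N : Fin η → ℕ} {b : ℝ} (s : Source N) (k : ℕ) (x : ℝ)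
    (q : ℕ) : DominatesRate ν (q * loadRatio d N + mRatio d N s k)
      (x + (q * dTilde d - d s.1) * b + dTilde d * b) (gammaL d N b ν s k x (q + 1)) := by
  intro θ hθ hint
  rw [gammaL, if_neg q.succ_ne_zero]
  have hl : (0 : ℝ) < (q + 1 : ℕ) := by positivity
  have hle : ((θ * (x / (q + 1 : ℕ) + (((q + 1 : ℕ) : ℝ) * dTilde d - d s.1) / (q + 1 : ℕ) * b)
      - (((q + 1 : ℕ) : ℝ) - 1) * loadRatio d N / (q + 1 : ℕ) * cgf id ν θ
      - mRatio d N s k / (q + 1 : ℕ) * cgf id ν θ : ℝ) : EReal)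
      ≤ ratePos d N ν (mRatio d N s k) (q + 1)
        (x / (q + 1 : ℕ) + (((q + 1 : ℕ) : ℝ) * dTilde d - d s.1) / (q + 1 : ℕ) * b) := by
    refine le_iSup_of_le ⟨θ, hθ⟩ ?_
    rw [logMGF_eq_cgf hint]
    simp only [EReal.coe_sub, EReal.coe_mul _ (cgf id ν θ)]
    exact le_rfl
  refine le_trans ?_ (mul_le_mul_of_nonneg_left hle (EReal.coe_nonneg.2 hl.le))
  rw [← EReal.coe_mul, EReal.coe_le_coe_iff]
  refine le_of_eq ?_
  field_simp
  push_cast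
  ring

/-- With the slack `σ`, the lower bound for `P(S_M ≥ n z)` is uniform for `n ≤ M ≤ C n`. -/
lemma exp_rate_le_convPow_of_slack (hν : ∀ᵐ v ∂ν, 0 ≤ v)
    (hmgf : ∃ θ : ℝ, 0 < θ ∧ Integrable (fun v => Real.exp (θ * v)) ν) (z : ℝ) {σ C ε : ℝ}
    (hσ : 0 < σ) (hC : 0 < C) (hε : 0 < ε) :
    ∃ n₀ : ℕ, ∀ n : ℕ, n₀ ≤ n → ∀ M : ℕ, n ≤ M → (M : ℝ) ≤ C * n → ∀ G : EReal,
      DominatesRate ν (M / n) (z + σ) G →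
      EReal.exp (-(((n : ℝ) : EReal) * (G + (ε : EReal)))) ≤ convPow ν M (Set.Ici (n * z)) := by
  have hσC : 0 < σ / C := div_pos hσ hC
  -- Among the multiples of `σ / C`, take one beyond `z` if all have positive tails, otherwise the
  -- last before the tail vanishes.
  obtain ⟨τ, hτ, hτ'⟩ : ∃ τ, 0 < ν (Set.Ici τ) ∧
      (z ≤ τ ∧ 0 ≤ τ ∨ ν (Set.Ici (τ + σ / C)) = 0) := by
    by_cases h : ∀ j : ℕ, 0 < ν (Set.Ici (j * (σ / C)))
    · obtain ⟨j, hj⟩ := exists_nat_ge (z / (σ / C))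
      rw [div_le_iff₀ hσC] at hj
      exact ⟨_, h j, Or.inl ⟨hj, by positivity⟩⟩
    · push Not at h
      classical
      have hspec := Nat.find_spec h
      have hne : Nat.find h ≠ 0 := by
        intro h0
        have := convPow_Ici_of_nonpos hν 1 (le_refl (0 : ℝ))
        rw [convPow_one] at this
        rw [h0] at hspec
        simp [this] at hspec
      obtain ⟨j, hj⟩ := Nat.exists_eq_succ_of_ne_zero hne
      refine ⟨j * (σ / C), ?_, Or.inr ?_⟩
      · exact not_le.1 (Nat.find_min h (m := j) (by omega))
      · rw [hj] at hspec
        rw [← nonpos_iff_eq_zero]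
        convert hspec using 3
        push_cast; ring
  obtain ⟨n₀, hn₀⟩ := exp_rate_le_convPow hν hmgf hτ z hC hε
  refine ⟨max n₀ 1, fun n hn M hnM hMC G hG => ?_⟩
  have hn0 : (0 : ℝ) < n := by
    have : 1 ≤ n := (le_max_right _ _).trans hn
    positivity
  have hnM' : (n : ℝ) ≤ M := by exact_mod_cast hnM
  rcases le_or_gt (n * z) (M * τ) with h | h
  · exact hn₀ n ((le_max_left _ _).trans hn) M hMC h G (hG.mono (by linarith))
  rcases hτ' with ⟨h1, h2⟩ | hnull
  · nlinarith
  have hr : 0 < (M : ℝ) / n := div_pos (hn0.trans_le hnM') hn0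
  -- As `M / n ≤ C`, the slack gives `(z + σ) / (M / n) ≥ τ + σ / C`, a level that `V` almost surely
  -- does not reach.
  have hGtop : G = ⊤ := by
    refine rate_eq_top hr (measure_mono_null (Set.Ici_subset_Ici.2 ?_) hnull) hG
    rw [le_div_iff₀ hr, add_mul]
    have h1 : τ * (M / n) ≤ z := by
      rw [mul_div_assoc', div_le_iff₀ hn0]; linarith
    have h2 : σ / C * (M / n) ≤ σ := by
      rw [div_mul_div_comm, div_le_iff₀ (by positivity)]
      exact mul_le_mul_of_nonneg_left hMC hσ.le
    linarith
  rw [hGtop, EReal.top_add_coe, EReal.coe_mul_top_of_pos hn0, EReal.neg_top, EReal.exp_bot]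
  exact zero_le

/-- Under a regular tail, the most likely way in which few summands get large is that each of them
is large. -/
lemma exp_rate_le_convPow_of_tail {n M : ℕ} (hn : 0 < n) (hM : 0 < M) {z ε : ℝ} (hz : z ≠ 0)
    (htail : EReal.exp (-(rateZero ν 1 (z / (M / n)) + ((ε / z * (z / (M / n)) : ℝ) : EReal)))
      ≤ ν (Set.Ici (z / (M / n)))) {G : EReal} (hG : DominatesRate ν (M / n) z G) :
    EReal.exp (-(((n : ℝ) : EReal) * (G + (ε : EReal)))) ≤ convPow ν M (Set.Ici (n * z)) := by
  have hn0 : (0 : ℝ) < n := by exact_mod_cast hn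
  have hM0 : (0 : ℝ) < M := by exact_mod_cast hM
  set r : ℝ := M / n
  have hr : 0 < r := by positivity
  induction G with
  | bot =>
    -- Impossible: the assumed tail bound would then have left side `∞`.
    have h1 : rateZero ν 1 (z / r) = ⊥ := eq_bot_iff.2 <| rateZero_le one_pos fun θ hθ hint =>
      absurd (hG θ hθ hint) (EReal.bot_lt_coe _).not_ge
    rw [h1] at htail
    simp at htail
  | top =>
    rw [EReal.top_add_coe, EReal.coe_mul_top_of_pos hn0, EReal.neg_top, EReal.exp_bot]
    exact zero_le
  | coe g =>
    have h1 : rateZero ν 1 (z / r) ≤ ((g / r : ℝ) : EReal) := by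
      refine rateZero_le one_pos fun θ hθ hint => ?_
      have := EReal.coe_le_coe_iff.1 (hG θ hθ hint)
      rw [EReal.coe_le_coe_iff, le_div_iff₀ hr]
      refine le_trans (le_of_eq ?_) this
      field_simp
    have h2 : ENNReal.ofReal (Real.exp (-(g / r + ε / z * (z / r)))) ≤ ν (Set.Ici (z / r)) := by
      refine le_trans ?_ htail
      rw [← EReal.exp_coe]
      refine EReal.exp_monotone ?_
      rw [EReal.coe_neg, EReal.neg_le_neg_iff, EReal.coe_add]
      gcongr
    have h3 : (M : ℝ) * (z / r) = n * z := by simp only [r]; field_simp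
    calc EReal.exp (-(((n : ℝ) : EReal) * ((g : EReal) + (ε : EReal))))
        = ENNReal.ofReal (Real.exp (-(g / r + ε / z * (z / r)))) ^ M := by
          rw [← EReal.coe_add, ← EReal.coe_mul, ← EReal.coe_neg, EReal.exp_coe,
            ← ENNReal.ofReal_pow (Real.exp_pos _).le, ← Real.exp_nat_mul]
          congr 2
          simp only [r]
          field_simp
      _ ≤ ν (Set.Ici (z / r)) ^ M := by gcongr
      _ ≤ _ := by rw [← h3]; exact pow_le_convPow ν M _

end Rates

/-! ### Reduction to sums, and the iterations with slack -/

section Reduction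

variable {η : ℕ} {d : Fin η → ℕ} {b : ℝ} {ν : Measure ℝ} [IsProbabilityMeasure ν]

/-- The index `ℓ' = q + 1 ≤ k'` uses only `q` full iterations, so the window does not reach before
round `0`. -/
lemma mul_dTilde_le_of_lt_kPrime (hd : ∀ j, 0 < d j) {g : Fin η} {k q : ℕ}
    (hq : q < kPrime d g k) : q * dTilde d ≤ d g * (k - 1) := by
  rw [kPrime, Nat.lt_ceil, lt_div_iff₀ (by exact_mod_cast dTilde_pos hd)] at hq
  push_cast at hq
  have : ((q * dTilde d : ℕ) : ℝ) < ((d g * (k - 1) : ℕ) : ℝ) := by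
    push_cast; linarith
  exact_mod_cast this.le

lemma lowerBoundHolds_of_convPow {N : Fin η → ℕ} (hd : ∀ j, 0 < d j) (hb : 0 ≤ b)
    (hN : 0 < numSources N) (s : Source N) {k : ℕ} (hk : 0 < k) {x ε : ℝ}
    (h0 : ∀ G : EReal, DominatesRate ν (mRatio d N s k) (x - d s.1 * b) G →
      EReal.exp (-(((numSources N : ℝ) : EReal) * (G + (ε : EReal))))
        ≤ convPow ν (Jminus d N s k).length (Set.Ici (numSources N * (x - d s.1 * b))))
    (h1 : ∀ q, 1 ≤ q → q < kPrime d s.1 k → ∀ G : EReal,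
      DominatesRate ν ((recentPackets d N s k (q * dTilde d)).length / numSources N)
        (x + (q * dTilde d - d s.1) * b + dTilde d * b) G →
      EReal.exp (-(((numSources N : ℝ) : EReal) * (G + (ε : EReal))))
        ≤ convPow ν (recentPackets d N s k (q * dTilde d)).length
          (Set.Ici (numSources N * (x + (q * dTilde d - d s.1) * b)))) :
    LowerBoundHolds.{u} d N b ν s k x ε := by
  intro Ω _ P _ V hV hi
  have hfirst : ∀ G : EReal, DominatesRate ν (mRatio d N s k) (x - d s.1 * b) G →
      EReal.exp (-(((numSources N : ℝ) : EReal) * (G + (ε : EReal))))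
        ≤ P {ω | numSources N * x ≤ peakAge d N b (fun p => V p ω) s k} := by
    intro G hG
    refine (h0 G hG).trans ?_
    have := convPow_le_measure_peakAge (d := d) (b := b) hV hi s hk x (q := 0) (by simp)
    simpa [recentPackets, sub_eq_add_neg] using this
  obtain ⟨⟨l, hl⟩, hmin⟩ := exists_eq_ciInf_of_finite
    (f := fun l : Fin (kPrime d s.1 k + 1) => gammaL d N b ν s k x l)
  rw [← hmin]
  dsimp only
  rcases l with _ | q
  · exact hfirst _ (dominatesRate_gammaL_zero s k x)
  have hG := dominatesRate_gammaL_succ (d := d) (b := b) (ν := ν) s k x q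
  -- For `ℓ' = 1` the load is that of `ℓ' = 0` and the threshold is larger, so the bound for the
  -- current round covers it.
  rcases Nat.eq_zero_or_pos q with rfl | hq
  · refine hfirst _ (DominatesRate.mono (z := x + ((0 : ℕ) * dTilde d - d s.1) * b
      + dTilde d * b) ?_ ?_)
    · simpa using hG
    · have : 0 ≤ (dTilde d : ℝ) * b := by positivity
      push_cast; linarith
  · have hq' : q < kPrime d s.1 k := by omega
    refine (h1 q hq hq' _ ?_).trans
      (convPow_le_measure_peakAge hV hi s hk x (mul_dTilde_le_of_lt_kPrime hd hq'))
    rwa [length_recentPackets hd hN, mul_div_cancel_left₀ _ (by exact_mod_cast hN.ne')]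

/-- The bounds for the iterations before the last one hold for all large systems. -/
lemma exists_forall_iterations_bound (hd : ∀ j, 0 < d j) (hb : 0 < b) (hν : ∀ᵐ v ∂ν, 0 ≤ v)
    (hmgf : ∃ θ : ℝ, 0 < θ ∧ Integrable (fun v => Real.exp (θ * v)) ν) (g : Fin η) (k : ℕ)
    (x : ℝ) {ε : ℝ} (hε : 0 < ε) :
    ∃ n₀ : ℕ, 1 ≤ n₀ ∧ ∀ N : Fin η → ℕ, n₀ ≤ numSources N → ∀ i : Fin (N g),
      ∀ q, 1 ≤ q → q < kPrime d g k → ∀ G : EReal,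
      DominatesRate ν ((recentPackets d N ⟨g, i⟩ k (q * dTilde d)).length / numSources N)
        (x + (q * dTilde d - d g) * b + dTilde d * b) G →
      EReal.exp (-(((numSources N : ℝ) : EReal) * (G + (ε : EReal))))
        ≤ convPow ν (recentPackets d N ⟨g, i⟩ k (q * dTilde d)).length
          (Set.Ici (numSources N * (x + (q * dTilde d - d g) * b))) := by
  have hdT : (0 : ℝ) < dTilde d := by exact_mod_cast dTilde_pos hd
  -- `C` bounds `M / n = q * loadRatio + m`, by `loadRatio ≤ d̃` and `m ≤ 1`; `M ≥ n` comes from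
  -- `loadRatio ≥ 1`.
  choose n₀ hn₀ using fun q : ℕ => exp_rate_le_convPow_of_slack hν hmgf
    (x + (q * dTilde d - d g) * b) (σ := dTilde d * b) (C := q * dTilde d + 1)
    (by positivity) (by positivity) hε
  refine ⟨(Finset.range (kPrime d g k)).sup n₀ + 1, by omega, fun N hN i q hq1 hq G hG => ?_⟩
  have hN0 : 0 < numSources N := by omega
  have hN0' : (0 : ℝ) < numSources N := by exact_mod_cast hN0
  have hlen := length_recentPackets hd hN0 ⟨g, i⟩ k q
  have hq1' : (1 : ℝ) ≤ q := by exact_mod_cast hq1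
  have hL := one_le_loadRatio hd hN0
  have hL' := loadRatio_le hd hN0
  have hm := mRatio_pos (d := d) hN0 ⟨g, i⟩ k
  have hm' := mRatio_le_one (d := d) hN0 ⟨g, i⟩ k
  refine hn₀ q _ ?_ _ ?_ ?_ G hG
  · exact (Finset.le_sup (Finset.mem_range.2 hq)).trans (by omega)
  · have : (numSources N : ℝ) ≤ (recentPackets d N ⟨g, i⟩ k (q * dTilde d)).length := by
      rw [hlen]
      refine le_mul_of_one_le_right hN0'.le ?_
      nlinarith
    exact_mod_cast this
  · rw [hlen, mul_comm]
    refine mul_le_mul_of_nonneg_right ?_ hN0'.le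
    have := mul_le_mul_of_nonneg_left hL' (by linarith : (0 : ℝ) ≤ q)
    linarith

end Reduction

end GRR

end

/-! ### The two claims -/

theorem mainTheorem2 {η : ℕ} [NeZero η] (d : Fin η → ℕ) (hd_one : d 0 = 1) (hd : StrictMono d)
    (b : ℝ) (hb : 0 < b)
    (ν : Measure ℝ) [IsProbabilityMeasure ν] (hν_nonneg : ∀ᵐ v ∂ν, 0 ≤ v)
    (hν_mgf : ∃ θ : ℝ, 0 < θ ∧ Integrable (fun v => Real.exp (θ * v)) ν)
    (g : Fin η) (k : ℕ) (hk : 0 < k) (x : ℝ) (hx : 0 < x) (ε : ℝ) (hε : 0 < ε) :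
    (∀ τ : ℝ, 0 < ν (Set.Ici τ) →
      ∃ n₀ : ℕ, ∀ N : Fin η → ℕ, n₀ ≤ GRR.numSources N → ∀ i : Fin (N g),
        (x - d g * b ≤ GRR.mRatio d N ⟨g, i⟩ k * τ ∨
          ν {v | x - d g * b ≤ GRR.mRatio d N ⟨g, i⟩ k * v} = 0) →
        GRR.LowerBoundHolds.{u} d N b ν ⟨g, i⟩ k x ε) ∧
    ((∀ t : ℝ, 0 < ν (Set.Ici t)) → GRR.RegularTail ν →
      ∃ n₀ : ℕ, ∀ N : Fin η → ℕ, n₀ ≤ GRR.numSources N → ∀ i : Fin (N g),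
        GRR.LowerBoundHolds.{u} d N b ν ⟨g, i⟩ k x ε) := by
  have hd0 : ∀ j, 0 < d j := fun j => by
    have := hd.monotone (Fin.zero_le j)
    omega
  obtain ⟨n₁, hn₁, hiter⟩ :=
    GRR.exists_forall_iterations_bound hd0 hb hν_nonneg hν_mgf g k x hε
  have hlen : ∀ N : Fin η → ℕ, 0 < GRR.numSources N → ∀ i : Fin (N g),
      ((GRR.Jminus d N ⟨g, i⟩ k).length : ℝ)
        = GRR.mRatio d N ⟨g, i⟩ k * GRR.numSources N := fun N hN i => by
    have : (GRR.numSources N : ℝ) ≠ 0 := by positivity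
    rw [GRR.mRatio, div_mul_cancel₀ _ this]
  have hramp : ∀ τ : ℝ, 0 < ν (Set.Ici τ) → ∃ n₀ : ℕ, ∀ N : Fin η → ℕ,
      n₀ ≤ GRR.numSources N → 0 < GRR.numSources N → ∀ i : Fin (N g),
      x - d g * b ≤ GRR.mRatio d N ⟨g, i⟩ k * τ → ∀ G : EReal,
      GRR.DominatesRate ν (GRR.mRatio d N ⟨g, i⟩ k) (x - d g * b) G →
      EReal.exp (-(((GRR.numSources N : ℝ) : EReal) * (G + (ε : EReal))))
        ≤ GRR.convPow ν (GRR.Jminus d N ⟨g, i⟩ k).length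
          (Set.Ici (GRR.numSources N * (x - d g * b))) := by
    intro τ hτ
    obtain ⟨n₀, hn₀⟩ := GRR.exp_rate_le_convPow hν_nonneg hν_mgf hτ (x - d g * b) one_pos hε
    refine ⟨n₀, fun N hN hN0 i hle G hG => hn₀ _ hN _ ?_ ?_ G hG⟩
    · rw [hlen N hN0]
      exact mul_le_mul_of_nonneg_right (GRR.mRatio_le_one hN0 _ k) (Nat.cast_nonneg _)
    · rw [hlen N hN0, mul_comm, mul_right_comm]
      exact mul_le_mul_of_nonneg_right hle (Nat.cast_nonneg _)
  constructor
  · intro τ hτ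
    obtain ⟨n₀, hn₀⟩ := hramp τ hτ
    refine ⟨max n₀ n₁, fun N hN i hcase => ?_⟩
    obtain ⟨hN₀, hN₁⟩ := max_le_iff.1 hN
    have hN0 : 0 < GRR.numSources N := by omega
    refine GRR.lowerBoundHolds_of_convPow hd0 hb.le hN0 ⟨g, i⟩ hk (fun G hG => ?_)
      (hiter N hN₁ i)
    rcases hcase with h | h
    · exact hn₀ N hN₀ hN0 i h G hG
    · have hm := GRR.mRatio_pos (d := d) hN0 ⟨g, i⟩ k
      have hGtop : G = ⊤ := by
        refine GRR.rate_eq_top hm (measure_mono_null (fun v hv => ?_) h) hG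
        rw [Set.mem_Ici, div_le_iff₀' hm] at hv
        exact hv
      rw [hGtop, EReal.top_add_coe, EReal.coe_mul_top_of_pos (by exact_mod_cast hN0),
        EReal.neg_top, EReal.exp_bot]
      exact zero_le
  · intro hunb hreg
    -- The tail error is `δ = ε / z` with `z = x - d_g b`: `M` summands at level `z / m` then lose
    -- `M δ z / m = n ε`.
    have hTex : ∃ T : ℝ, 0 ≤ T ∧ (0 < x - d g * b → ∀ t, T ≤ t →
        EReal.exp (-(GRR.rateZero ν 1 t + ((ε / (x - d g * b) * t : ℝ) : EReal)))
          ≤ ν (Set.Ici t)) := by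
      by_cases hz : 0 < x - d g * b
      · obtain ⟨T, hT⟩ := eventually_atTop.1 (hreg _ (div_pos hε hz))
        exact ⟨max T 0, le_max_right _ _, fun _ t ht => hT t ((le_max_left _ _).trans ht)⟩
      · exact ⟨0, le_rfl, fun h => absurd h hz⟩
    obtain ⟨T, hT0, hT⟩ := hTex
    obtain ⟨n₀, hn₀⟩ := hramp T (hunb T)
    refine ⟨max n₀ n₁, fun N hN i => ?_⟩
    obtain ⟨hN₀, hN₁⟩ := max_le_iff.1 hN
    have hN0 : 0 < GRR.numSources N := by omega
    refine GRR.lowerBoundHolds_of_convPow hd0 hb.le hN0 ⟨g, i⟩ hk (fun G hG => ?_)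
      (hiter N hN₁ i)
    -- If `m` is not too small for `T`, Cramér's bound applies; otherwise each summand must reach `z
    -- / m > T`, where the regular tail holds.
    rcases le_or_gt (x - d g * b) (GRR.mRatio d N ⟨g, i⟩ k * T) with h | h
    · exact hn₀ N hN₀ hN0 i h G hG
    · have hm := GRR.mRatio_pos (d := d) hN0 ⟨g, i⟩ k
      have hz : 0 < x - d g * b := (mul_nonneg hm.le hT0).trans_lt h
      refine GRR.exp_rate_le_convPow_of_tail hN0
        (List.length_pos_of_mem (GRR.packetIn_mem_Jminus _ k)) hz.ne' (hT hz _ ?_) hG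
      change T ≤ _ / GRR.mRatio d N ⟨g, i⟩ k
      rw [le_div_iff₀ hm, mul_comm]
      exact h.le
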